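/- A formal game is a finite game tree $G=\{G^L\mid G^R\}$ with finitely many Left options $G^L$ and Right options $G^R$ (short normal-play games). Write $G\le H$ if there is no $G^L$ with $H\le G^L$ and no $H^R$ with $H^R\le G$; write $G=H$ if $G\le H$ and $H\le G$ (the class of $G$ is its value); and say that $G$ is greater than or fuzzy with $H$ if $H\le G\not\le H$ or $G,H$ are incomparable, i.e. if $G\not\le H$. Sums and negatives of games are the disjunctive ones, and a dyadic rational $x\in\mathbb{Z}[\tfrac12]$ is identified, as a game, with its canonical form. For $t\in\mathbb{Z}[\tfrac12]$ define $\lambda_t(G),\rho_t(G)\in\mathbb{Z}[\tfrac12]$, the temperature $t(G)\in\mathbb{Z}[\tfrac12]\cup\{-\infty\}$ and the cooled game $G_t$ recursively. If $G$ is equal to an integer $n$, put $\lambda_t(G)=\rho_t(G)=n$, $G_t=n$ and $t(G)=-\infty$. Otherwise let $$\widetilde\lambda_t(G)=\max_{G^L}\bigl(\rho_t(G^L)-t\bigr),\qquad \widetilde\rho_t(G)=\min_{G^R}\bigl(\lambda_t(G^R)+t\bigr),\qquad \widetilde G_t=\{(G^L)_t-t\mid (G^R)_t+t\},$$ let $t(G)$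 be the least $t\in\mathbb{Z}[\tfrac12]$ with $\widetilde\lambda_t(G)=\widetilde\rho_t(G)$ (it exists), and let $x$ be the common value $\widetilde\lambda_{t(G)}(G)=\widetilde\rho_{t(G)}(G)$; put $\lambda_t(G)=\widetilde\lambda_t(G)$, $\rho_t(G)=\widetilde\rho_t(G)$, $G_t=\widetilde G_t$ if $t\le t(G)$, and $\lambda_t(G)=\rho_t(G)=x$, $G_t=x$ if $t>t(G)$. **Theorem.** Let $t\in\mathbb{Z}[\tfrac12]$ with $t>-1$. For all formal games $G,H$: 1. if $G\ge H$, then $G_t\ge H_t$; 2. if $G$ is greater than or fuzzy with $H$, then $G_t$ is greater than or fuzzy with $H_t-t$; 3. consequently, if $G=H$ then $G_t=H_t$, and there is a unique map from game values to game values that sends the value of $G$ to the value of $G_t$ for every formal game $G$. -/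

import Mathlib

/-- The ring `ℤ[1/2]` of dyadic rationals, as a subring of `ℚ`. -/
def ZHalf : Subring ℚ where
  carrier := {q | ∃ (k : ℤ) (n : ℕ), q = (k : ℚ) / 2 ^ n}
  mul_mem' := by
    rintro _ _ ⟨k, n, rfl⟩ ⟨k', n', rfl⟩
    exact ⟨k * k', n + n', by push_cast; rw [pow_add]; field_simp⟩
  one_mem' := ⟨1, 0, by simp⟩
  add_mem' := by
    rintro _ _ ⟨k, n, rfl⟩ ⟨k', n', rfl⟩
    exact ⟨k * 2 ^ n' + k' * 2 ^ n, n + n', by push_cast; rw [pow_add]; field_simp⟩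
  zero_mem' := ⟨0, 0, by simp⟩
  neg_mem' := by
    rintro _ ⟨k, n, rfl⟩
    exact ⟨-k, n, by push_cast; ring⟩

/-- Formal (short, normal-play) games `{G^L | G^R}`: finite game trees, a position being given by
a finite family of Left options and a finite family of Right options. -/
inductive FormalGame : Type
  | mk {m n : ℕ} (L : Fin m → FormalGame) (R : Fin n → FormalGame) : FormalGame

namespace FormalGame

/-- The number of Left options. -/
def numLeft : FormalGame → ℕ
  | @mk m _ _ _ => m

/-- The number of Right options. -/
def numRight : FormalGame → ℕ
  | @mk _ n _ _ => n

/-- The Left options. -/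
def left : (G : FormalGame) → Fin G.numLeft → FormalGame
  | mk L _ => L

/-- The Right options. -/
def right : (G : FormalGame) → Fin G.numRight → FormalGame
  | mk _ R => R

/-- The formal birthday: the height of the game tree. -/
def birthday : FormalGame → ℕ
  | mk L R => max (Finset.univ.sup fun i => birthday (L i) + 1)
      (Finset.univ.sup fun j => birthday (R j) + 1)

theorem birthday_left (G : FormalGame) (i : Fin G.numLeft) :
    (G.left i).birthday < G.birthday := by
  cases G with
  | mk L R =>
    rw [birthday]
    exact lt_max_of_lt_left (Nat.lt_of_succ_le
      (Finset.le_sup (f := fun i => birthday (L i) + 1) (Finset.mem_univ i)))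

theorem birthday_right (G : FormalGame) (j : Fin G.numRight) :
    (G.right j).birthday < G.birthday := by
  cases G with
  | mk L R =>
    rw [birthday]
    exact lt_max_of_lt_right (Nat.lt_of_succ_le
      (Finset.le_sup (f := fun i => birthday (R i) + 1) (Finset.mem_univ j)))

/-! ### The order -/

/-- `G ≤ H` if no Left option `G^L` satisfies `H ≤ G^L` and no Right option `H^R` satisfies
`H^R ≤ G`; that is, Left wins `H - G` if Right moves first. -/
def Le (G H : FormalGame) : Prop :=
  (∀ i, ¬ Le H (G.left i)) ∧ ∀ j, ¬ Le (H.right j) G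
termination_by G.birthday + H.birthday
decreasing_by
  · have := birthday_left G i; omega
  · have := birthday_right H j; omega

instance : LE FormalGame := ⟨Le⟩

theorem le_def (G H : FormalGame) :
    G ≤ H ↔ (∀ i, ¬ H ≤ G.left i) ∧ ∀ j, ¬ H.right j ≤ G := by
  change Le G H ↔ (∀ i, ¬ Le H (G.left i)) ∧ ∀ j, ¬ Le (H.right j) G
  rw [Le]

theorem le_refl' (G : FormalGame) : G ≤ G := by
  induction G with
  | mk L R ihL ihR =>
    rw [le_def]
    refine ⟨fun i h => ?_, fun j h => ?_⟩
    · exact ((le_def _ _).1 h).1 i (ihL i)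
    · exact ((le_def _ _).1 h).2 j (ihR j)

theorem le_trans' (G H K : FormalGame) (h₁ : G ≤ H) (h₂ : H ≤ K) : G ≤ K := by
  rw [le_def]
  refine ⟨fun i h => ?_, fun j h => ?_⟩
  · exact ((le_def _ _).1 h₁).1 i (le_trans' H K (G.left i) h₂ h)
  · exact ((le_def _ _).1 h₂).2 j (le_trans' (K.right j) G H h h₁)
termination_by G.birthday + H.birthday + K.birthday
decreasing_by
  · have := birthday_left G i; omega
  · have := birthday_right K j; omega

instance : Preorder FormalGame where
  le_refl := le_refl'
  le_trans := le_trans'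

/-- Equality of games (equality of their values), as opposed to identity of formal games:
`G ≤ H` and `H ≤ G`. -/
def Equal (G H : FormalGame) : Prop := AntisymmRel (· ≤ ·) G H

/-- `G` is greater than or fuzzy (incomparable) with `H`. -/
def GreaterOrFuzzy (G H : FormalGame) : Prop := H < G ∨ (¬ G ≤ H ∧ ¬ H ≤ G)

/-- The partially ordered set of game values: formal games modulo equality. -/
abbrev Value : Type := Antisymmetrization FormalGame (· ≤ ·)

/-- The value of a formal game. -/
def value (G : FormalGame) : Value := toAntisymmetrization (· ≤ ·) G

/-! ### The group operations -/

instance : Zero FormalGame := ⟨mk (m := 0) (n := 0) Fin.elim0 Fin.elim0⟩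

/-- `-G = {-G^R | -G^L}`. -/
def neg : FormalGame → FormalGame
  | mk L R => mk (fun j => neg (R j)) (fun i => neg (L i))

instance : Neg FormalGame := ⟨neg⟩

/-- The disjunctive sum `G + H = {G^L + H, G + H^L | G^R + H, G + H^R}`. -/
def add (G H : FormalGame) : FormalGame :=
  mk (Fin.append (fun i => add (G.left i) H) (fun i => add G (H.left i)))
    (Fin.append (fun j => add (G.right j) H) (fun j => add G (H.right j)))
termination_by G.birthday + H.birthday
decreasing_by
  · have := birthday_left G i; omega
  · have := birthday_left H i; omega
  · have := birthday_right G j; omega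
  · have := birthday_right H j; omega

instance : Add FormalGame := ⟨add⟩

/-- `G - H = G + (-H)`. -/
instance : Sub FormalGame := ⟨fun G H => G + -H⟩

/-! ### Canonical forms of numbers -/

/-- `0 = { | }` and `n + 1 = {n | }`. -/
def ofNat : ℕ → FormalGame
  | 0 => 0
  | n + 1 => mk (m := 1) (n := 0) (fun _ => ofNat n) Fin.elim0

/-- The canonical form of an integer. -/
def ofInt : ℤ → FormalGame
  | Int.ofNat n => ofNat n
  | Int.negSucc n => -ofNat (n + 1)

/-- The canonical form of `k / 2 ^ m`: for `m ≥ 1` and `k` odd it is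
`{(k - 1) / 2 ^ m | (k + 1) / 2 ^ m}`. -/
def ofFrac : ℕ → ℤ → FormalGame
  | 0, k => ofInt k
  | m + 1, k =>
    if Even k then ofFrac m (k / 2)
    else mk (m := 1) (n := 1) (fun _ => ofFrac m ((k - 1) / 2)) (fun _ => ofFrac m ((k + 1) / 2))

/-- The canonical form of a dyadic rational (whose reduced denominator is a power of `2`). -/
def ofDyadic (x : ZHalf) : FormalGame := ofFrac (Nat.log 2 (x : ℚ).den) (x : ℚ).num

/-! ### Thermographs, temperature and cooling -/

/-- `G` is equal to an integer. -/
def IsInt (G : FormalGame) : Prop := ∃ n : ℤ, Equal G (ofInt n)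

/-- The maximum of a finite family (`0` for the empty family; a game that is not equal to an
integer has options for both players). -/
def finMax {m : ℕ} (f : Fin m → ZHalf) : ZHalf :=
  if h : (Finset.univ : Finset (Fin m)).Nonempty then Finset.univ.sup' h f else 0

/-- The minimum of a finite family (`0` for the empty family). -/
def finMin {m : ℕ} (f : Fin m → ZHalf) : ZHalf :=
  if h : (Finset.univ : Finset (Fin m)).Nonempty then Finset.univ.inf' h f else 0

/-- The least `s ∈ ℤ[1/2]` with `f s = g s`. -/
noncomputable def firstMeet (f g : ZHalf → ZHalf) : ZHalf :=
  Classical.epsilon fun s => IsLeast {s | f s = g s} s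

open Classical in
/-- The pair `(λ(G), ρ(G))` of the walls of the thermograph, as functions of `t`. -/
noncomputable def walls : FormalGame → (ZHalf → ZHalf) × (ZHalf → ZHalf)
  | mk L R =>
    if h : IsInt (mk L R) then (fun _ => (h.choose : ZHalf), fun _ => (h.choose : ZHalf))
    else
      let lam : ZHalf → ZHalf := fun t => finMax fun i => (walls (L i)).2 t - t
      let rho : ZHalf → ZHalf := fun t => finMin fun j => (walls (R j)).1 t + t
      let T := firstMeet lam rho
      (fun t => if t ≤ T then lam t else lam T, fun t => if t ≤ T then rho t else lam T)

/-- The left wall `λ_t(G)`. -/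
noncomputable def leftWall (t : ZHalf) (G : FormalGame) : ZHalf := (walls G).1 t

/-- The right wall `ρ_t(G)`. -/
noncomputable def rightWall (t : ZHalf) (G : FormalGame) : ZHalf := (walls G).2 t

/-- The left scaffold: the maximum of `ρ_t(G^L) - t` over the Left options. -/
noncomputable def leftScaffold (t : ZHalf) (G : FormalGame) : ZHalf :=
  finMax fun i => rightWall t (G.left i) - t

/-- The right scaffold: the minimum of `λ_t(G^R) + t` over the Right options. -/
noncomputable def rightScaffold (t : ZHalf) (G : FormalGame) : ZHalf :=
  finMin fun j => leftWall t (G.right j) + t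

/-- For `G` not equal to an integer, the least `t` at which the scaffolds meet. -/
noncomputable def meetTime (G : FormalGame) : ZHalf :=
  firstMeet (fun t => leftScaffold t G) (fun t => rightScaffold t G)

open Classical in
/-- The temperature `t(G)`; it is `-∞` if `G` is equal to an integer. -/
noncomputable def temperature (G : FormalGame) : WithBot ZHalf :=
  if IsInt G then ⊥ else (meetTime G : WithBot ZHalf)

/-- The mast value `x = λ_{t(G)}(G)` of a game that is not equal to an integer. -/
noncomputable def mast (G : FormalGame) : ZHalf := leftWall (meetTime G) G

open Classical in
/-- The game `G_t`, that is, `G` cooled by `t`. -/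
noncomputable def cool (t : ZHalf) : FormalGame → FormalGame
  | mk L R =>
    if h : IsInt (mk L R) then ofInt h.choose
    else if (t : WithBot ZHalf) ≤ temperature (mk L R) then
      mk (fun i => cool t (L i) - ofDyadic t) (fun j => cool t (R j) + ofDyadic t)
    else ofDyadic (mast (mk L R))

/-- The recursion that defines the left wall. -/
theorem leftWall_of_not_isInt (t : ZHalf) (G : FormalGame) (h : ¬ IsInt G) :
    leftWall t G = if (t : WithBot ZHalf) ≤ temperature G then leftScaffold t G else mast G := by
  have key : ∀ s, leftWall s G =
      if s ≤ meetTime G then leftScaffold s G else leftScaffold (meetTime G) G := by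
    intro s
    cases G with
    | mk L R =>
      rw [leftWall, walls, dif_neg h]
      rfl
  simp only [temperature, mast, h, if_false, WithBot.coe_le_coe, key, le_refl, if_true]

/-- The recursion that defines the right wall. -/
theorem rightWall_of_not_isInt (t : ZHalf) (G : FormalGame) (h : ¬ IsInt G) :
    rightWall t G = if (t : WithBot ZHalf) ≤ temperature G then rightScaffold t G else mast G := by
  have key : rightWall t G =
      if t ≤ meetTime G then rightScaffold t G else leftScaffold (meetTime G) G := by
    cases G with
    | mk L R =>
      rw [rightWall, walls, dif_neg h]
      rfl
  have hm : mast G = leftScaffold (meetTime G) G := by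
    rw [mast, leftWall_of_not_isInt _ _ h]
    simp [temperature, h]
  simp only [temperature, h, if_false, WithBot.coe_le_coe, key, hm]

/-- The recursion that defines cooling. -/
theorem cool_of_not_isInt (t : ZHalf) (G : FormalGame) (h : ¬ IsInt G) :
    cool t G = if (t : WithBot ZHalf) ≤ temperature G then
      mk (fun i => cool t (G.left i) - ofDyadic t) (fun j => cool t (G.right j) + ofDyadic t)
    else ofDyadic (mast G) := by
  cases G with
  | mk L R =>
    rw [cool, dif_neg h]
    rfl

end FormalGame

/-!
The two assertions imply each other by induction on options as long as one of the two games has not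
yet frozen at its mast value. The difficulty is the frozen phase. The walls `λ_t(G)` and `ρ_t(G)`
are the Left and Right stops of `G_t`, so an inequality between cooled games gives an inequality
between walls; in the other direction the walls at temperature `t` determine the comparisons of
`G_t` with numbers only up to infinitesimals, but the walls at a lower temperature `s < t` decide
these as well. If `G` is frozen at `t`, the theorem at the temperature of `G` thus yields the
theorem at `t`. For a game equal to an integer, the temperature `s = -1` plays this role: there the
walls of `H` are the least integer above and the greatest integer below `H`, and the walls of a game
that is not an integer still cross in the wrong order, so that its temperature exceeds `-1`.
-/

namespace FormalGame

open Set Filter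

/-! ### The ordered group of game values -/

/-- The set of Left options of `G`, forgetting the indexing. -/
def leftOptions (G : FormalGame) : Set FormalGame := range G.left

/-- The set of Right options of `G`, forgetting the indexing. -/
def rightOptions (G : FormalGame) : Set FormalGame := range G.right

variable {G H X Y : FormalGame}

theorem birthday_lt_of_mem_leftOptions (h : X ∈ G.leftOptions) : X.birthday < G.birthday := by
  obtain ⟨i, rfl⟩ := h
  exact birthday_left G i

theorem birthday_lt_of_mem_rightOptions (h : Y ∈ G.rightOptions) : Y.birthday < G.birthday := by
  obtain ⟨j, rfl⟩ := h
  exact birthday_right G j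

theorem le_iff_options :
    G ≤ H ↔ (∀ X ∈ G.leftOptions, ¬ H ≤ X) ∧ ∀ Y ∈ H.rightOptions, ¬ Y ≤ G := by
  rw [le_def, leftOptions, rightOptions, forall_mem_range, forall_mem_range]

theorem not_le_of_mem_leftOptions (h : X ∈ G.leftOptions) : ¬ G ≤ X :=
  (le_iff_options.1 le_rfl).1 X h

theorem not_le_of_mem_rightOptions (h : Y ∈ G.rightOptions) : ¬ Y ≤ G :=
  (le_iff_options.1 le_rfl).2 Y h

theorem leftOptions_zero : (0 : FormalGame).leftOptions = ∅ := range_eq_empty (ι := Fin 0) _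

theorem rightOptions_zero : (0 : FormalGame).rightOptions = ∅ := range_eq_empty (ι := Fin 0) _

theorem leftOptions_neg (G : FormalGame) : (-G).leftOptions = Neg.neg '' G.rightOptions := by
  cases G
  exact range_comp _ _

theorem rightOptions_neg (G : FormalGame) : (-G).rightOptions = Neg.neg '' G.leftOptions := by
  cases G
  exact range_comp _ _

theorem range_append {α : Type*} {m n : ℕ} (a : Fin m → α) (b : Fin n → α) :
    range (Fin.append a b) = range a ∪ range b := by
  ext x
  constructor
  · rintro ⟨i, rfl⟩
    induction i using Fin.addCases <;> simp
  · rintro (⟨i, rfl⟩ | ⟨j, rfl⟩)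
    · exact ⟨Fin.castAdd n i, Fin.append_left a b i⟩
    · exact ⟨Fin.natAdd m j, Fin.append_right a b j⟩

theorem leftOptions_add (G H : FormalGame) :
    (G + H).leftOptions = (· + H) '' G.leftOptions ∪ (G + ·) '' H.leftOptions := by
  change range (add G H).left = _
  rw [add, leftOptions, leftOptions, ← range_comp, ← range_comp]
  exact range_append _ _

theorem rightOptions_add (G H : FormalGame) :
    (G + H).rightOptions = (· + H) '' G.rightOptions ∪ (G + ·) '' H.rightOptions := by
  change range (add G H).right = _
  rw [add, rightOptions, rightOptions, ← range_comp, ← range_comp]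
  exact range_append _ _

theorem add_right_mem_leftOptions (h : X ∈ G.leftOptions) (H : FormalGame) :
    X + H ∈ (G + H).leftOptions :=
  leftOptions_add G H ▸ Or.inl (mem_image_of_mem _ h)

theorem add_left_mem_leftOptions (G : FormalGame) (h : X ∈ H.leftOptions) :
    G + X ∈ (G + H).leftOptions :=
  leftOptions_add G H ▸ Or.inr (mem_image_of_mem _ h)

theorem add_right_mem_rightOptions (h : Y ∈ G.rightOptions) (H : FormalGame) :
    Y + H ∈ (G + H).rightOptions :=
  rightOptions_add G H ▸ Or.inl (mem_image_of_mem _ h)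

theorem add_left_mem_rightOptions (G : FormalGame) (h : Y ∈ H.rightOptions) :
    G + Y ∈ (G + H).rightOptions :=
  rightOptions_add G H ▸ Or.inr (mem_image_of_mem _ h)

theorem neg_mem_leftOptions (h : Y ∈ G.rightOptions) : -Y ∈ (-G).leftOptions :=
  leftOptions_neg G ▸ mem_image_of_mem _ h

theorem neg_mem_rightOptions (h : X ∈ G.leftOptions) : -X ∈ (-G).rightOptions :=
  rightOptions_neg G ▸ mem_image_of_mem _ h

protected theorem neg_neg (G : FormalGame) : - -G = G := by
  induction G with
  | mk L R ihL ihR => exact congrArg₂ mk (funext ihL) (funext ihR)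

protected theorem neg_zero : -(0 : FormalGame) = 0 :=
  congrArg₂ mk (Subsingleton.elim _ _) (Subsingleton.elim _ _)

protected theorem neg_le_neg_iff (G H : FormalGame) : -G ≤ -H ↔ H ≤ G := by
  rw [le_iff_options, le_iff_options, leftOptions_neg, rightOptions_neg, forall_mem_image,
    forall_mem_image, and_comm]
  exact and_congr
    (forall₂_congr fun X _ => not_congr (FormalGame.neg_le_neg_iff X G))
    (forall₂_congr fun Y _ => not_congr (FormalGame.neg_le_neg_iff H Y))
termination_by G.birthday + H.birthday
decreasing_by
  · have := birthday_lt_of_mem_leftOptions ‹X ∈ _›; omega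
  · have := birthday_lt_of_mem_rightOptions ‹Y ∈ _›; omega

protected theorem add_le_add_iff_right (G H K : FormalGame) : G + K ≤ H + K ↔ G ≤ H := by
  constructor <;> intro h
  · refine le_iff_options.2 ⟨fun X hX hHX => ?_, fun Y hY hYG => ?_⟩
    · exact (le_iff_options.1 h).1 _ (add_right_mem_leftOptions hX K)
        ((FormalGame.add_le_add_iff_right H X K).2 hHX)
    · exact (le_iff_options.1 h).2 _ (add_right_mem_rightOptions hY K)
        ((FormalGame.add_le_add_iff_right Y G K).2 hYG)
  · rw [le_iff_options, leftOptions_add, rightOptions_add]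
    simp only [mem_union, or_imp, forall_and, forall_mem_image]
    refine ⟨⟨fun X hX hle => ?_, fun X hX hle => ?_⟩, fun Y hY hle => ?_, fun Y hY hle => ?_⟩
    · exact (le_iff_options.1 h).1 X hX ((FormalGame.add_le_add_iff_right H X K).1 hle)
    · exact not_le_of_mem_leftOptions (add_left_mem_leftOptions H hX)
        (hle.trans ((FormalGame.add_le_add_iff_right G H X).2 h))
    · exact (le_iff_options.1 h).2 Y hY ((FormalGame.add_le_add_iff_right Y G K).1 hle)
    · exact not_le_of_mem_rightOptions (add_left_mem_rightOptions G hY)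
        (((FormalGame.add_le_add_iff_right G H Y).2 h).trans hle)
termination_by G.birthday + H.birthday + K.birthday
decreasing_by
  all_goals
    first
    | have := birthday_lt_of_mem_leftOptions hX; omega
    | have := birthday_lt_of_mem_rightOptions hY; omega

theorem value_le_value : value G ≤ value H ↔ G ≤ H := Iff.rfl

theorem value_eq_value : value G = value H ↔ Equal G H :=
  le_antisymm_iff

theorem value_surjective : Function.Surjective value := Quotient.mk_surjective

theorem value_le_value_iff_options : value G ≤ value H ↔
    (∀ X ∈ G.leftOptions, ¬ value H ≤ value X) ∧ ∀ Y ∈ H.rightOptions, ¬ value Y ≤ value G :=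
  le_iff_options

theorem value_le_value_of_options (hl : value '' G.leftOptions ⊆ value '' H.leftOptions)
    (hr : value '' H.rightOptions ⊆ value '' G.rightOptions) : value G ≤ value H := by
  refine value_le_value_iff_options.2 ⟨fun X hX hle => ?_, fun Y hY hle => ?_⟩
  · obtain ⟨X', hX', h⟩ := hl (mem_image_of_mem value hX)
    exact not_le_of_mem_leftOptions hX' (value_le_value.1 (h ▸ hle))
  · obtain ⟨Y', hY', h⟩ := hr (mem_image_of_mem value hY)
    exact not_le_of_mem_rightOptions hY' (value_le_value.1 (h ▸ hle))

theorem value_eq_value_of_options (hl : value '' G.leftOptions = value '' H.leftOptions)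
    (hr : value '' G.rightOptions = value '' H.rightOptions) : value G = value H :=
  (value_le_value_of_options hl.subset hr.superset).antisymm
    (value_le_value_of_options hl.superset hr.subset)

theorem value_add_comm (G H : FormalGame) : value (G + H) = value (H + G) := by
  apply value_eq_value_of_options
  · simp only [leftOptions_add, image_union, image_image]
    rw [union_comm]
    exact congrArg₂ _ (image_congr fun X _ => value_add_comm G X)
      (image_congr fun X _ => value_add_comm X H)
  · simp only [rightOptions_add, image_union, image_image]
    rw [union_comm]
    exact congrArg₂ _ (image_congr fun Y _ => value_add_comm G Y)
      (image_congr fun Y _ => value_add_comm Y H)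
termination_by G.birthday + H.birthday
decreasing_by
  all_goals
    first
    | have := birthday_lt_of_mem_leftOptions ‹X ∈ _›; omega
    | have := birthday_lt_of_mem_rightOptions ‹Y ∈ _›; omega

theorem value_add_assoc (G H K : FormalGame) : value (G + H + K) = value (G + (H + K)) := by
  apply value_eq_value_of_options
  · simp only [leftOptions_add, image_union, image_image, union_assoc]
    exact congrArg₂ _ (image_congr fun X _ => value_add_assoc X H K) (congrArg₂ _
      (image_congr fun X _ => value_add_assoc G X K)
      (image_congr fun X _ => value_add_assoc G H X))
  · simp only [rightOptions_add, image_union, image_image, union_assoc]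
    exact congrArg₂ _ (image_congr fun Y _ => value_add_assoc Y H K) (congrArg₂ _
      (image_congr fun Y _ => value_add_assoc G Y K)
      (image_congr fun Y _ => value_add_assoc G H Y))
termination_by G.birthday + H.birthday + K.birthday
decreasing_by
  all_goals
    first
    | have := birthday_lt_of_mem_leftOptions ‹X ∈ _›; omega
    | have := birthday_lt_of_mem_rightOptions ‹Y ∈ _›; omega

theorem value_add_zero (G : FormalGame) : value (G + 0) = value G := by
  apply value_eq_value_of_options
  · simp only [leftOptions_add, leftOptions_zero, image_empty, union_empty, image_image]
    exact image_congr fun X _ => value_add_zero X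
  · simp only [rightOptions_add, rightOptions_zero, image_empty, union_empty, image_image]
    exact image_congr fun Y _ => value_add_zero Y
termination_by G.birthday
decreasing_by
  · exact birthday_lt_of_mem_leftOptions ‹X ∈ _›
  · exact birthday_lt_of_mem_rightOptions ‹Y ∈ _›

theorem value_neg_add_self (G : FormalGame) : value (-G + G) = value 0 := by
  apply le_antisymm <;> rw [value_le_value_iff_options]
  · rw [leftOptions_add, leftOptions_neg, rightOptions_zero]
    simp only [mem_union, or_imp, forall_and, forall_mem_image, mem_empty_iff_false, false_imp_iff,
      implies_true, and_true]
    refine ⟨fun Y hY => ?_, fun X hX => ?_⟩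
    · rw [← value_neg_add_self Y]
      exact not_le_of_mem_rightOptions (add_left_mem_rightOptions _ hY)
    · rw [← value_neg_add_self X]
      exact not_le_of_mem_rightOptions (add_right_mem_rightOptions (neg_mem_rightOptions hX) _)
  · rw [rightOptions_add, rightOptions_neg, leftOptions_zero]
    simp only [mem_union, or_imp, forall_and, forall_mem_image, mem_empty_iff_false, false_imp_iff,
      implies_true, true_and]
    refine ⟨fun X hX => ?_, fun Y hY => ?_⟩
    · rw [← value_neg_add_self X]
      exact not_le_of_mem_leftOptions (add_left_mem_leftOptions _ hX)
    · rw [← value_neg_add_self Y]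
      exact not_le_of_mem_leftOptions (add_right_mem_leftOptions (neg_mem_leftOptions hY) _)
termination_by G.birthday
decreasing_by
  all_goals
    first
    | exact birthday_lt_of_mem_leftOptions hX
    | exact birthday_lt_of_mem_rightOptions hY

instance : Zero Value := ⟨value 0⟩

instance : Add Value := ⟨Quotient.map₂ (· + ·) fun G G' hG H H' hH =>
  have add_right {X X' : FormalGame} (h : Equal X X') (Y : FormalGame) :
      value (X + Y) = value (X' + Y) :=
    value_eq_value.2 (h.imp (FormalGame.add_le_add_iff_right _ _ Y).2
      (FormalGame.add_le_add_iff_right _ _ Y).2)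
  value_eq_value.1 <| calc
    value (G + H) = value (G' + H) := add_right hG H
    _ = value (H + G') := value_add_comm _ _
    _ = value (H' + G') := add_right hH G'
    _ = value (G' + H') := value_add_comm _ _⟩

instance : Neg Value := ⟨Quotient.map (- ·) fun G H h =>
  ⟨(FormalGame.neg_le_neg_iff G H).2 h.2, (FormalGame.neg_le_neg_iff H G).2 h.1⟩⟩

theorem value_zero : value 0 = 0 := rfl

theorem value_add (G H : FormalGame) : value (G + H) = value G + value H := rfl

theorem value_neg (G : FormalGame) : value (-G) = -value G := rfl

instance : AddCommGroup Value where
  add_assoc := value_surjective.forall₃.2 value_add_assoc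
  zero_add := value_surjective.forall.2 fun G => (value_add_comm 0 G).trans (value_add_zero G)
  add_zero := value_surjective.forall.2 value_add_zero
  neg_add_cancel := value_surjective.forall.2 value_neg_add_self
  add_comm := value_surjective.forall₂.2 value_add_comm
  nsmul := nsmulRec
  zsmul := zsmulRec

instance : IsOrderedAddMonoid Value where
  add_le_add_left := value_surjective.forall₂.2 fun G H h => value_surjective.forall.2 fun K =>
    (FormalGame.add_le_add_iff_right G H K).2 h

theorem value_sub (G H : FormalGame) : value (G - H) = value G - value H := by
  rw [sub_eq_add_neg]
  rfl

theorem greaterOrFuzzy_iff_not_le : GreaterOrFuzzy G H ↔ ¬ G ≤ H := by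
  rw [GreaterOrFuzzy, lt_iff_le_not_ge]
  tauto

/-! ### Numbers -/

theorem ofInt_neg (k : ℤ) : ofInt (-k) = -ofInt k := by
  rcases k with (_ | n) | n
  · exact FormalGame.neg_zero.symm
  · rfl
  · exact (FormalGame.neg_neg _).symm

theorem mem_leftOptions_ofInt {k : ℤ} : X ∈ (ofInt k).leftOptions ↔ 0 < k ∧ X = ofInt (k - 1) := by
  rcases k with (_ | n) | n
  · exact iff_of_false (fun h => leftOptions_zero.subset h) fun h => h.1.false
  · have hn : ofInt (Int.ofNat (n + 1) - 1) = ofNat n :=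
      congrArg ofInt (show Int.ofNat (n + 1) - 1 = Int.ofNat n by simp)
    rw [hn]
    exact ⟨fun ⟨_, h⟩ => ⟨Int.natCast_pos.2 n.succ_pos, h.symm⟩,
      fun ⟨_, h⟩ => ⟨(0 : Fin 1), h.symm⟩⟩
  · exact iff_of_false (fun ⟨i, _⟩ => i.elim0) fun h => (Int.negSucc_lt_zero n).not_gt h.1

theorem ofFrac_zero (k : ℤ) : ofFrac 0 k = ofInt k := by rw [ofFrac]

theorem ofFrac_succ_two_mul (m : ℕ) (k : ℤ) : ofFrac (m + 1) (2 * k) = ofFrac m k := by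
  rw [ofFrac, if_pos (even_two_mul k), Int.mul_ediv_cancel_left k two_ne_zero]

theorem ofFrac_succ_two_mul_add_one (m : ℕ) (k : ℤ) : ofFrac (m + 1) (2 * k + 1) =
    mk (m := 1) (n := 1) (fun _ => ofFrac m k) (fun _ => ofFrac m (k + 1)) := by
  rw [ofFrac, if_neg (Int.not_even_two_mul_add_one k),
    show (2 * k + 1 - 1) / 2 = k by lia, show (2 * k + 1 + 1) / 2 = k + 1 by lia]

theorem ofFrac_neg (m : ℕ) (k : ℤ) : ofFrac m (-k) = -ofFrac m k := by
  induction m generalizing k with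
  | zero => rw [ofFrac_zero, ofFrac_zero, ofInt_neg]
  | succ m ih =>
    rcases Int.even_or_odd' k with ⟨l, rfl | rfl⟩
    · rw [← mul_neg, ofFrac_succ_two_mul, ofFrac_succ_two_mul, ih]
    · rw [show -(2 * l + 1) = 2 * -(l + 1) + 1 by ring, ofFrac_succ_two_mul_add_one,
        ofFrac_succ_two_mul_add_one, show -(l + 1) + 1 = -l by ring, ih, ih]
      rfl

theorem exists_lt_of_mem_leftOptions_ofFrac {m : ℕ} {k : ℤ} (hX : X ∈ (ofFrac m k).leftOptions) :
    ∃ k' < k, X = ofFrac m k' := by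
  induction m generalizing k with
  | zero =>
    rw [ofFrac_zero, mem_leftOptions_ofInt] at hX
    exact ⟨k - 1, sub_one_lt k, hX.2.trans (ofFrac_zero _).symm⟩
  | succ m ih =>
    rcases Int.even_or_odd' k with ⟨l, rfl | rfl⟩
    · rw [ofFrac_succ_two_mul] at hX
      obtain ⟨l', hl', rfl⟩ := ih hX
      exact ⟨2 * l', by lia, (ofFrac_succ_two_mul m l').symm⟩
    · rw [ofFrac_succ_two_mul_add_one] at hX
      obtain ⟨_, rfl⟩ := hX
      exact ⟨2 * l, by lia, (ofFrac_succ_two_mul m l).symm⟩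

theorem exists_gt_of_mem_rightOptions_ofFrac {m : ℕ} {k : ℤ}
    (hY : Y ∈ (ofFrac m k).rightOptions) : ∃ k' > k, Y = ofFrac m k' := by
  have hX := neg_mem_leftOptions hY
  rw [← ofFrac_neg] at hX
  obtain ⟨k', hk', h⟩ := exists_lt_of_mem_leftOptions_ofFrac hX
  exact ⟨-k', by lia, by rw [ofFrac_neg, ← h, FormalGame.neg_neg]⟩

theorem ofFrac_sub_one_mem_leftOptions_of_odd (m : ℕ) {k : ℤ} (hk : Odd k) :
    ofFrac (m + 1) (k - 1) ∈ (ofFrac (m + 1) k).leftOptions := by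
  obtain ⟨l, rfl⟩ := hk
  rw [add_sub_cancel_right, ofFrac_succ_two_mul, ofFrac_succ_two_mul_add_one]
  exact ⟨(0 : Fin 1), rfl⟩

theorem exists_mem_leftOptions_ofFrac_of_add_add_pos (m : ℕ) {k l n : ℤ} (h : 0 < k + l + n) :
    (∃ k', ofFrac m k' ∈ (ofFrac m k).leftOptions ∧ 0 ≤ k' + l + n) ∨
    (∃ l', ofFrac m l' ∈ (ofFrac m l).leftOptions ∧ 0 ≤ k + l' + n) ∨
    ∃ n', ofFrac m n' ∈ (ofFrac m n).leftOptions ∧ 0 ≤ k + l + n' := by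
  induction m generalizing k l n with
  | zero =>
    simp only [ofFrac_zero, mem_leftOptions_ofInt]
    obtain hk | hl | hn : 0 < k ∨ 0 < l ∨ 0 < n := by lia
    · exact .inl ⟨k - 1, ⟨hk, rfl⟩, by lia⟩
    · exact .inr (.inl ⟨l - 1, ⟨hl, rfl⟩, by lia⟩)
    · exact .inr (.inr ⟨n - 1, ⟨hn, rfl⟩, by lia⟩)
  | succ m ih =>
    by_cases hk : Odd k
    · exact .inl ⟨k - 1, ofFrac_sub_one_mem_leftOptions_of_odd m hk, by lia⟩
    by_cases hl : Odd l
    · exact .inr (.inl ⟨l - 1, ofFrac_sub_one_mem_leftOptions_of_odd m hl, by lia⟩)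
    by_cases hn : Odd n
    · exact .inr (.inr ⟨n - 1, ofFrac_sub_one_mem_leftOptions_of_odd m hn, by lia⟩)
    rw [Int.not_odd_iff_even, even_iff_two_dvd] at hk hl hn
    obtain ⟨⟨k, rfl⟩, ⟨l, rfl⟩, ⟨n, rfl⟩⟩ := And.intro hk (And.intro hl hn)
    simp only [ofFrac_succ_two_mul]
    rcases ih (show 0 < k + l + n by lia) with ⟨k', h₁, h₂⟩ | ⟨l', h₁, h₂⟩ | ⟨n', h₁, h₂⟩
    · exact .inl ⟨2 * k', by rwa [ofFrac_succ_two_mul], by lia⟩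
    · exact .inr (.inl ⟨2 * l', by rwa [ofFrac_succ_two_mul], by lia⟩)
    · exact .inr (.inr ⟨2 * n', by rwa [ofFrac_succ_two_mul], by lia⟩)

/- The sign of a sum of three numbers with a common denominator: with two zero summands this is the
order of numbers, with the third one equal to minus the sum of the others it is their additivity. -/
theorem ofFrac_add_add_nonneg_and_pos (m : ℕ) (k l n : ℤ) :
    (0 ≤ k + l + n → 0 ≤ ofFrac m k + ofFrac m l + ofFrac m n) ∧
    (0 < k + l + n → ¬ ofFrac m k + ofFrac m l + ofFrac m n ≤ 0) := by
  refine ⟨fun h => ?_, fun h hle => ?_⟩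
  · rw [le_iff_options, leftOptions_zero, rightOptions_add, rightOptions_add]
    refine ⟨fun X hX => hX.elim, ?_⟩
    rintro _ (⟨_, ⟨Y, hY, rfl⟩ | ⟨Y, hY, rfl⟩, rfl⟩ | ⟨Y, hY, rfl⟩) <;>
      obtain ⟨r, hr, rfl⟩ := exists_gt_of_mem_rightOptions_ofFrac hY
    · exact (ofFrac_add_add_nonneg_and_pos m r l n).2 (by lia)
    · exact (ofFrac_add_add_nonneg_and_pos m k r n).2 (by lia)
    · exact (ofFrac_add_add_nonneg_and_pos m k l r).2 (by lia)
  · rcases exists_mem_leftOptions_ofFrac_of_add_add_pos m h with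
      ⟨r, hX, hr⟩ | ⟨r, hX, hr⟩ | ⟨r, hX, hr⟩
    · exact (le_iff_options.1 hle).1 _ (add_right_mem_leftOptions
        (add_right_mem_leftOptions hX _) _) ((ofFrac_add_add_nonneg_and_pos m r l n).1 hr)
    · exact (le_iff_options.1 hle).1 _ (add_right_mem_leftOptions
        (add_left_mem_leftOptions _ hX) _) ((ofFrac_add_add_nonneg_and_pos m k r n).1 hr)
    · exact (le_iff_options.1 hle).1 _ (add_left_mem_leftOptions _ hX)
        ((ofFrac_add_add_nonneg_and_pos m k l r).1 hr)
termination_by (ofFrac m k).birthday + (ofFrac m l).birthday + (ofFrac m n).birthday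
decreasing_by
  all_goals
    first
    | have := birthday_lt_of_mem_leftOptions hX; lia
    | have := birthday_lt_of_mem_rightOptions hY; lia

theorem value_ofFrac_add (m : ℕ) (k l : ℤ) :
    value (ofFrac m (k + l)) = value (ofFrac m k) + value (ofFrac m l) := by
  have nonneg {a b c : ℤ} (h : 0 ≤ a + b + c) :
      0 ≤ value (ofFrac m a) + value (ofFrac m b) + value (ofFrac m c) :=
    (ofFrac_add_add_nonneg_and_pos m a b c).1 h
  have value_ofFrac_neg (a : ℤ) : value (ofFrac m (-a)) = -value (ofFrac m a) :=
    congrArg value (ofFrac_neg m a)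
  have ge := nonneg (show 0 ≤ k + l + -(k + l) by lia)
  have le := nonneg (show 0 ≤ -k + -l + (k + l) by lia)
  rw [value_ofFrac_neg, ← sub_eq_add_neg, sub_nonneg] at ge
  rw [value_ofFrac_neg, value_ofFrac_neg, ← neg_add, neg_add_eq_sub, sub_nonneg] at le
  exact ge.antisymm le

theorem value_ofFrac_pos (m : ℕ) {k : ℤ} (hk : 0 < k) : 0 < value (ofFrac m k) := by
  have value_ofFrac_zero : value (ofFrac m 0) = 0 := by
    simpa only [add_zero, left_eq_add] using value_ofFrac_add m 0 0
  have h := ofFrac_add_add_nonneg_and_pos m k 0 0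
  simp only [← value_le_value, value_add, value_zero, value_ofFrac_zero, add_zero] at h
  exact lt_of_le_not_ge (h.1 hk.le) (h.2 hk)

theorem ofDyadic_eq_ofFrac {x : ZHalf} {m : ℕ} {k : ℤ} (h : (x : ℚ) = k / 2 ^ m) :
    ofDyadic x = ofFrac m k := by
  induction m generalizing k with
  | zero =>
    rw [pow_zero, div_one] at h
    simp only [ofDyadic, h, Rat.den_intCast, Rat.num_intCast, Nat.log_one_right]
  | succ m ih =>
    rcases Int.even_or_odd k with hk | hk
    · obtain ⟨k, rfl⟩ := even_iff_two_dvd.1 hk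
      rw [ofFrac_succ_two_mul]
      apply ih
      rw [h, pow_succ]
      push_cast
      field_simp
    · have coprime : Nat.Coprime k.natAbs ((2 : ℤ) ^ (m + 1)).natAbs := by
        rw [Int.natAbs_pow]
        exact Nat.Coprime.pow_right _ (Nat.coprime_two_right.2 (Int.natAbs_odd.2 hk))
      have h' : (x : ℚ) = (k : ℚ) / ((2 ^ (m + 1) : ℤ) : ℚ) := by rw [h]; push_cast; rfl
      have num_eq : (x : ℚ).num = k := h' ▸ Rat.num_div_eq_of_coprime (by positivity) coprime
      have den_eq : (x : ℚ).den = 2 ^ (m + 1) := by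
        exact_mod_cast h' ▸ Rat.den_div_eq_of_coprime (by positivity) coprime
      rw [ofDyadic, num_eq, den_eq, Nat.log_pow one_lt_two]

theorem exists_common_denominator (x y : ZHalf) :
    ∃ (m : ℕ) (k l : ℤ), (x : ℚ) = k / 2 ^ m ∧ (y : ℚ) = l / 2 ^ m := by
  obtain ⟨k, m, hx⟩ := x.2
  obtain ⟨l, n, hy⟩ := y.2
  refine ⟨m + n, k * 2 ^ n, l * 2 ^ m, ?_, ?_⟩
  · rw [hx, pow_add]; push_cast; field_simp
  · rw [hy, pow_add]; push_cast; field_simp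

/-- The embedding of the dyadic rationals into the group of game values. -/
def numValue : ZHalf →+ Value := AddMonoidHom.mk' (fun x => value (ofDyadic x)) fun x y => by
  obtain ⟨m, k, l, hx, hy⟩ := exists_common_denominator x y
  have hxy : ((x + y : ZHalf) : ℚ) = ((k + l : ℤ) : ℚ) / 2 ^ m := by
    push_cast
    rw [hx, hy, add_div]
  rw [ofDyadic_eq_ofFrac hx, ofDyadic_eq_ofFrac hy, ofDyadic_eq_ofFrac hxy, value_ofFrac_add]

theorem value_ofDyadic (x : ZHalf) : value (ofDyadic x) = numValue x := rfl

theorem numValue_strictMono : StrictMono numValue := by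
  refine (strictMono_iff_map_pos numValue).2 fun x hx => ?_
  obtain ⟨k, m, h⟩ := x.2
  have x_pos : (0 : ℚ) < x := hx
  rw [h, div_pos_iff_of_pos_right (by positivity)] at x_pos
  rw [← value_ofDyadic, ofDyadic_eq_ofFrac h]
  exact value_ofFrac_pos m (Int.cast_pos.1 x_pos)

theorem numValue_le_numValue {x y : ZHalf} : numValue x ≤ numValue y ↔ x ≤ y :=
  numValue_strictMono.le_iff_le

theorem exists_gt_of_mem_rightOptions_ofDyadic {x : ZHalf} (hY : Y ∈ (ofDyadic x).rightOptions) :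
    ∃ y > x, value Y = numValue y := by
  obtain ⟨k, m, hx⟩ := x.2
  rw [ofDyadic_eq_ofFrac hx] at hY
  obtain ⟨k', hk', rfl⟩ := exists_gt_of_mem_rightOptions_ofFrac hY
  refine ⟨⟨k' / 2 ^ m, k', m, rfl⟩, ?_, by rw [← value_ofDyadic, ofDyadic_eq_ofFrac rfl]⟩
  rw [gt_iff_lt, ← Subtype.coe_lt_coe, hx]
  exact div_lt_div_of_pos_right (Int.cast_lt.2 hk') (by positivity)

theorem value_ofInt (n : ℤ) : value (ofInt n) = numValue n := by
  rw [← ofFrac_zero, ← value_ofDyadic,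
    ofDyadic_eq_ofFrac (show ((n : ZHalf) : ℚ) = n / 2 ^ 0 by simp)]

theorem ofInt_le_ofInt {k l : ℤ} : ofInt k ≤ ofInt l ↔ k ≤ l := by
  rw [← value_le_value, value_ofInt, value_ofInt, numValue_le_numValue, Int.cast_le]

/-! ### Walls -/

theorem le_finMax {m : ℕ} (f : Fin m → ZHalf) (i : Fin m) : f i ≤ finMax f := by
  rw [finMax, dif_pos ⟨i, Finset.mem_univ i⟩]
  exact Finset.le_sup' f (Finset.mem_univ i)

theorem exists_finMax_eq {m : ℕ} (hm : 0 < m) (f : Fin m → ZHalf) : ∃ i, finMax f = f i := by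
  rw [finMax, dif_pos ⟨⟨0, hm⟩, Finset.mem_univ _⟩]
  obtain ⟨i, -, hi⟩ := Finset.exists_mem_eq_sup' _ f
  exact ⟨i, hi⟩

theorem finMax_of_isEmpty (f : Fin 0 → ZHalf) : finMax f = 0 := dif_neg (by simp)

theorem finMax_neg {m : ℕ} (f : Fin m → ZHalf) : finMax (fun i => -f i) = -finMin f := by
  rw [finMax, finMin]
  split_ifs with h
  · exact (map_finset_inf' (OrderIso.neg ZHalf) h f).symm
  · exact neg_zero.symm

theorem exists_finMin_eq {m : ℕ} (hm : 0 < m) (f : Fin m → ZHalf) : ∃ i, finMin f = f i := by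
  obtain ⟨i, hi⟩ := exists_finMax_eq hm fun i => -f i
  exact ⟨i, neg_injective (finMax_neg f ▸ hi)⟩

theorem finMax_le_iff {m : ℕ} (hm : 0 < m) {f : Fin m → ZHalf} {c : ZHalf} :
    finMax f ≤ c ↔ ∀ i, f i ≤ c := by
  refine ⟨fun h i => (le_finMax f i).trans h, fun h => ?_⟩
  obtain ⟨i, hi⟩ := exists_finMax_eq hm f
  exact hi ▸ h i

theorem finMin_le {m : ℕ} (f : Fin m → ZHalf) (i : Fin m) : finMin f ≤ f i :=
  neg_le_neg_iff.1 (finMax_neg f ▸ le_finMax (fun i => -f i) i)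

theorem finMin_le_iff {m : ℕ} (hm : 0 < m) {f : Fin m → ZHalf} {c : ZHalf} :
    finMin f ≤ c ↔ ∃ i, f i ≤ c := by
  refine ⟨fun h => ?_, fun ⟨i, hi⟩ => (finMin_le f i).trans hi⟩
  obtain ⟨i, hi⟩ := exists_finMin_eq hm f
  exact ⟨i, hi ▸ h⟩

theorem le_finMin_iff {m : ℕ} (hm : 0 < m) {f : Fin m → ZHalf} {c : ZHalf} :
    c ≤ finMin f ↔ ∀ i, c ≤ f i := by
  rw [← neg_le_neg_iff, ← finMax_neg, finMax_le_iff hm]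
  simp only [neg_le_neg_iff]

theorem finMax_le_finMax_add {m : ℕ} {f g : Fin m → ZHalf} {c : ZHalf} (hc : 0 ≤ c)
    (h : ∀ i, f i ≤ g i + c) : finMax f ≤ finMax g + c := by
  rcases m.eq_zero_or_pos with rfl | hm
  · rwa [finMax_of_isEmpty, finMax_of_isEmpty, zero_add]
  · exact (finMax_le_iff hm).2 fun i => (h i).trans (add_le_add_left (le_finMax g i) c)

/-- The dyadic rational `1 / 2 ^ N`. -/
def mesh (N : ℕ) : ZHalf := ⟨1 / 2 ^ N, 1, N, by simp⟩

/-- The grid of the integer multiples of `1 / 2 ^ N`. -/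
def grid (N : ℕ) : AddSubgroup ZHalf := AddSubgroup.zmultiples (mesh N)

theorem mesh_pos (N : ℕ) : 0 < mesh N :=
  show (0 : ℚ) < 1 / 2 ^ N by positivity

theorem mem_grid {N : ℕ} {x : ZHalf} : x ∈ grid N ↔ ∃ k : ℤ, k * mesh N = x := by
  simp only [grid, AddSubgroup.mem_zmultiples_iff, zsmul_eq_mul]

theorem eventually_mem_grid (x : ZHalf) : ∀ᶠ N in atTop, x ∈ grid N := by
  obtain ⟨k, n, hx⟩ := x.2
  filter_upwards [eventually_ge_atTop n] with N hN
  obtain ⟨m, rfl⟩ := Nat.exists_eq_add_of_le hN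
  refine mem_grid.2 ⟨k * 2 ^ m, Subtype.ext ?_⟩
  simp only [mesh, hx, pow_add, Subring.coe_mul, Subring.coe_intCast]
  push_cast
  field_simp

theorem exists_two_mul_eq (x : ZHalf) : ∃ y, 2 * y = x :=
  ⟨x * mesh 1, Subtype.ext (show (2 : ℚ) * (x * (1 / 2 ^ 1)) = x by ring)⟩

instance : DenselyOrdered ZHalf where
  dense x z hxz := by
    obtain ⟨y, hy⟩ := exists_two_mul_eq (x + z)
    exact ⟨y, by linarith, by linarith⟩

/-- The functions that occur as walls of thermographs: `f` is piecewise affine with slopes `0` and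
`-1` and dyadic nodes. The last property is encoded as the invariance of all fine enough grids. -/
structure IsWall (f : ZHalf → ZHalf) : Prop where
  antitone : Antitone f
  monotone_add_id : Monotone fun t => f t + t
  mapsTo_grid : ∀ᶠ N in atTop, ∀ a ∈ grid N, f a ∈ grid N

variable {f g : ZHalf → ZHalf}

theorem isWall_const (c : ZHalf) : IsWall fun _ => c where
  antitone := antitone_const
  monotone_add_id := monotone_const.add monotone_id
  mapsTo_grid := (eventually_mem_grid c).mono fun _ h _ _ => h

theorem IsWall.sub_id (hf : IsWall fun t => -f t) : IsWall fun t => f t - t where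
  antitone s t hst := by
    have := hf.monotone_add_id hst
    dsimp only at this ⊢
    linarith
  monotone_add_id := by simpa only [sub_add_cancel, neg_neg] using hf.antitone.neg
  mapsTo_grid := hf.mapsTo_grid.mono fun _ h a ha => sub_mem (neg_mem_iff.1 (h a ha)) ha

theorem isWall_finMax {m : ℕ} {f : Fin m → ZHalf → ZHalf} (hf : ∀ i, IsWall (f i)) :
    IsWall fun t => finMax fun i => f i t where
  antitone s t hst := by
    simpa only [add_zero] using finMax_le_finMax_add le_rfl fun i => by
      simpa only [add_zero] using (hf i).antitone hst
  monotone_add_id s t hst := by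
    have := finMax_le_finMax_add (sub_nonneg.2 hst) fun i =>
      show f i s ≤ f i t + (t - s) by linarith [show _ + s ≤ _ + t from (hf i).monotone_add_id hst]
    dsimp only
    linarith
  mapsTo_grid := (eventually_all.2 fun i => (hf i).mapsTo_grid).mono fun N h a ha => by
    rcases m.eq_zero_or_pos with rfl | hm
    · exact finMax_of_isEmpty _ ▸ zero_mem _
    · obtain ⟨i, hi⟩ := exists_finMax_eq hm fun i => f i a
      exact hi ▸ h i a ha

theorem IsWall.comp_min (hf : IsWall f) (T : ZHalf) : IsWall fun t => f (min t T) where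
  antitone s t hst := hf.antitone (min_le_min_right T hst)
  monotone_add_id s t hst := by
    have h₁ : f (min s T) + min s T ≤ f (min t T) + min t T :=
      hf.monotone_add_id (min_le_min_right T hst)
    have h₂ : s - min s T ≤ t - min t T := by
      rcases le_total s T with h | h
      · rw [min_eq_left h, sub_self, sub_nonneg]
        exact min_le_left t T
      · rw [min_eq_right h, min_eq_right (h.trans hst)]
        exact sub_le_sub_right hst T
    dsimp only
    linarith
  mapsTo_grid := (hf.mapsTo_grid.and (eventually_mem_grid T)).mono fun N h a ha => h.1 _ <| by
    rcases min_choice a T with h' | h' <;> rw [h']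
    exacts [ha, h.2]

theorem IsWall.exists_slope (hf : IsWall f) {N : ℕ} (hN : ∀ a ∈ grid N, f a ∈ grid N)
    {a : ZHalf} (ha : a ∈ grid N) :
    ∃ c : ZHalf, (c = 0 ∨ c = 1) ∧ ∀ s ∈ Icc a (a + mesh N), f s = f a - c * (s - a) := by
  have hpos := mesh_pos N
  obtain ⟨k, hk⟩ := mem_grid.1 <| sub_mem (hN a ha)
    (hN _ (add_mem ha (AddSubgroup.mem_zmultiples (mesh N))))
  have anti {s t : ZHalf} (hst : s ≤ t) : f t ≤ f s := hf.antitone hst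
  have mono {s t : ZHalf} (hst : s ≤ t) : f s + s ≤ f t + t := hf.monotone_add_id hst
  have h₁ := anti (le_add_of_nonneg_right (a := a) hpos.le)
  have h₂ := mono (le_add_of_nonneg_right (a := a) hpos.le)
  have k_nonneg : (-1 : ZHalf) < k := by nlinarith
  have k_le_one : (k : ZHalf) < 2 := by nlinarith
  obtain rfl | rfl : k = 0 ∨ k = 1 := by
    have : -1 < k := by exact_mod_cast k_nonneg
    have : k < 2 := by exact_mod_cast k_le_one
    lia
  · refine ⟨0, .inl rfl, fun s hs => ?_⟩
    rw [Int.cast_zero] at hk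
    linarith [anti hs.1, anti hs.2]
  · refine ⟨1, .inr rfl, fun s hs => ?_⟩
    rw [Int.cast_one] at hk
    linarith [mono hs.1, mono hs.2]

theorem exists_grid_cell {N : ℕ} {P : ZHalf → Prop} {r s : ZHalf} (hr : r ∈ grid N)
    (hPr : ¬ P r) (hP : ∀ t ≥ s, P t) : ∃ a ∈ grid N, ¬ P a ∧ P (a + mesh N) := by
  obtain ⟨n, hn⟩ := Archimedean.arch (s - r) (mesh_pos N)
  obtain ⟨m, hm, hm'⟩ := Nat.exists_not_and_succ_of_not_zero_of_exists
    (p := fun k : ℕ => P (r + k • mesh N)) (by simpa only [zero_nsmul, add_zero])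
    ⟨n, hP _ (sub_le_iff_le_add'.1 hn)⟩
  refine ⟨r + m • mesh N, add_mem hr (nsmul_mem (AddSubgroup.mem_zmultiples _) m), hm, ?_⟩
  rwa [succ_nsmul, ← add_assoc] at hm'

theorem exists_add_mul_eq {c d v w : ZHalf} (hc : c = 0 ∨ c = 1) (hd : d = 0 ∨ d = 1) (hv : 0 < v)
    (hw : v ≤ (c + d) * w) : 0 < c + d ∧ ∃ u, 0 < u ∧ u ≤ w ∧ (c + d) * u = v := by
  obtain ⟨hcd, u, hu⟩ : 0 < c + d ∧ ∃ u, (c + d) * u = v := by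
    rcases hc with rfl | rfl <;> rcases hd with rfl | rfl
    · linarith
    · exact ⟨by norm_num, v, by ring⟩
    · exact ⟨by norm_num, v, by ring⟩
    · exact ⟨by norm_num, (exists_two_mul_eq v).imp fun u hu => by rwa [one_add_one_eq_two]⟩
  exact ⟨hcd, u, pos_of_mul_pos_right (hu ▸ hv) hcd.le, le_of_mul_le_mul_left (hu ▸ hw) hcd, hu⟩

/- `f` and `g` are affine on a grid cell at whose ends `f - g` has opposite signs. -/
theorem exists_isLeast_eq (hf : IsWall f) (hg : IsWall fun t => -g t) {r s : ZHalf}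
    (hr : g r < f r) (hs : f s ≤ g s) : ∃ T > r, IsLeast {t | f t = g t} T := by
  have anti {s t : ZHalf} (hst : s ≤ t) : f t - g t ≤ f s - g s := by
    linarith [hf.antitone hst, show -g t ≤ -g s from hg.antitone hst]
  obtain ⟨N, hfN, hgN, hrN⟩ :=
    (hf.mapsTo_grid.and (hg.mapsTo_grid.and (eventually_mem_grid r))).exists
  obtain ⟨a, haN, ha, hb⟩ := exists_grid_cell (P := fun t => f t - g t ≤ 0) hrN (by linarith)
    fun t ht => (anti ht).trans (sub_nonpos.2 hs)
  rw [not_le] at ha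
  obtain ⟨c, hc, hfc⟩ := hf.exists_slope hfN haN
  obtain ⟨d, hd, hgd⟩ := hg.exists_slope hgN haN
  have hpos := mesh_pos N
  have slope {t : ZHalf} (ht : t ∈ Icc a (a + mesh N)) :
      f t - g t = f a - g a - (c + d) * (t - a) := by
    linarith [hfc t ht, hgd t ht]
  have drop := slope (right_mem_Icc.2 (by linarith))
  rw [add_sub_cancel_left] at drop
  obtain ⟨hcd, u, u_pos, u_le, hu⟩ := exists_add_mul_eq hc hd ha (w := mesh N) (by linarith)
  have meet : f (a + u) = g (a + u) := by
    have := slope (t := a + u) ⟨by linarith, by linarith⟩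
    rw [add_sub_cancel_left, hu, sub_self] at this
    exact sub_eq_zero.1 this
  refine ⟨a + u, ?_, meet, fun t (ht : f t = g t) => ?_⟩
  · by_contra! hle
    linarith [anti hle]
  · by_contra! hlt
    rcases le_total t a with hta | hat
    · linarith [anti hta]
    · have := slope ⟨hat, by linarith⟩
      have : (c + d) * (t - a) < (c + d) * u := mul_lt_mul_of_pos_left (by linarith) hcd
      linarith

/-! ### Integers -/

theorem isInt_neg_iff : IsInt (-G) ↔ IsInt G := by
  have neg {G : FormalGame} (h : IsInt G) : IsInt (-G) := by
    obtain ⟨n, hle, hge⟩ := h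
    refine ⟨-n, ?_⟩
    rw [ofInt_neg]
    exact ⟨(FormalGame.neg_le_neg_iff _ _).2 hge, (FormalGame.neg_le_neg_iff _ _).2 hle⟩
  exact ⟨fun h => G.neg_neg ▸ neg h, neg⟩

theorem rightOptions_ofInt_of_nonneg {n : ℤ} (hn : 0 ≤ n) : (ofInt n).rightOptions = ∅ := by
  have : (ofInt (-n)).leftOptions = ∅ :=
    eq_empty_of_forall_notMem fun X hX => by
      have := (mem_leftOptions_ofInt.1 hX).1
      lia
  rw [← neg_neg n, ofInt_neg, rightOptions_neg, this, image_empty]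

theorem le_ofInt_birthday (G : FormalGame) : G ≤ ofInt G.birthday := by
  refine le_iff_options.2 ⟨fun X hX h => ?_, fun Y hY => ?_⟩
  · have hlt := birthday_lt_of_mem_leftOptions hX
    have hle := ofInt_le_ofInt.1 (h.trans (le_ofInt_birthday X))
    lia
  · exact absurd hY (rightOptions_ofInt_of_nonneg (Int.natCast_nonneg _) ▸ notMem_empty Y)
termination_by G.birthday

theorem ofInt_le_of_rightOptions (hG : ¬ IsInt G) {n : ℤ}
    (h : ∀ Y ∈ G.rightOptions, ¬ Y ≤ ofInt n) : ofInt n ≤ G := by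
  refine le_iff_options.2 ⟨fun X hX hle => hG ?_, h⟩
  obtain ⟨_, rfl⟩ := mem_leftOptions_ofInt.1 hX
  exact ⟨n - 1, hle, ofInt_le_of_rightOptions hG fun Y hY hY' =>
    h Y hY (hY'.trans (ofInt_le_ofInt.2 (sub_le_self n zero_le_one)))⟩
termination_by n.toNat

theorem ofInt_le_iff_rightOptions (hG : ¬ IsInt G) {n : ℤ} :
    ofInt n ≤ G ↔ ∀ Y ∈ G.rightOptions, ¬ Y ≤ ofInt n :=
  ⟨fun h => (le_iff_options.1 h).2, ofInt_le_of_rightOptions hG⟩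

theorem le_ofInt_iff_leftOptions (hG : ¬ IsInt G) {n : ℤ} :
    G ≤ ofInt n ↔ ∀ X ∈ G.leftOptions, ¬ ofInt n ≤ X := by
  rw [← FormalGame.neg_le_neg_iff, ← ofInt_neg, ofInt_le_iff_rightOptions (isInt_neg_iff.not.2 hG),
    rightOptions_neg, forall_mem_image]
  refine forall₂_congr fun X _ => not_congr ?_
  rw [ofInt_neg]
  exact FormalGame.neg_le_neg_iff X (ofInt n)

theorem numRight_pos (hG : ¬ IsInt G) : 0 < G.numRight := by
  by_contra! h
  have hle : ofInt (G.birthday + 1) ≤ G := ofInt_le_of_rightOptions hG fun Y ⟨j, _⟩ =>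
    absurd j.2 (by lia)
  have := ofInt_le_ofInt.1 (hle.trans (le_ofInt_birthday G))
  lia

theorem numLeft_pos (hG : ¬ IsInt G) : 0 < G.numLeft := by
  have := numRight_pos (isInt_neg_iff.not.2 hG)
  cases G
  exact this

/-! ### Thermographs -/

theorem exists_ofInt_of_isInt (h : IsInt G) : ∃ n : ℤ, Equal G (ofInt n) ∧
    ∀ t, leftWall t G = n ∧ rightWall t G = n ∧ cool t G = ofInt n := by
  refine ⟨h.choose, h.choose_spec, fun t => ?_⟩
  cases G with
  | mk L R => simp only [leftWall, rightWall, walls, cool, dif_pos h, and_self]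

theorem leftScaffold_le_iff (hG : ¬ IsInt G) {t x : ZHalf} :
    leftScaffold t G ≤ x ↔ ∀ X ∈ G.leftOptions, rightWall t X ≤ x + t := by
  rw [leftScaffold, finMax_le_iff (numLeft_pos hG), leftOptions, forall_mem_range]
  simp only [sub_le_iff_le_add]

theorem le_rightScaffold_iff (hG : ¬ IsInt G) {t x : ZHalf} :
    x ≤ rightScaffold t G ↔ ∀ Y ∈ G.rightOptions, x - t ≤ leftWall t Y := by
  rw [rightScaffold, le_finMin_iff (numRight_pos hG), rightOptions, forall_mem_range]
  simp only [sub_le_iff_le_add]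

/-- The shape of a thermograph: both walls are piecewise affine, they do not cross, and their
values at `-1` are the least integer above `G` and the greatest integer below `G`. -/
structure HasThermograph (G : FormalGame) : Prop where
  isWall_leftWall : IsWall fun t => leftWall t G
  isWall_neg_rightWall : IsWall fun t => -rightWall t G
  rightWall_le_leftWall : ∀ t, rightWall t G ≤ leftWall t G
  leftWall_neg_one : ∃ n : ℤ, leftWall (-1) G = n ∧ ∀ m, G ≤ ofInt m ↔ n ≤ m
  rightWall_neg_one : ∃ n : ℤ, rightWall (-1) G = n ∧ ∀ m, ofInt m ≤ G ↔ m ≤ n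

theorem hasThermograph_of_isInt (h : IsInt G) : HasThermograph G := by
  obtain ⟨n, ⟨hle, hge⟩, hw⟩ := exists_ofInt_of_isInt h
  constructor
  · simpa only [hw] using isWall_const n
  · simpa only [hw] using isWall_const (-n)
  · exact fun t => ((hw t).2.1.trans (hw t).1.symm).le
  · refine ⟨n, (hw _).1, fun m => ?_⟩
    rw [← ofInt_le_ofInt]
    exact ⟨hge.trans, hle.trans⟩
  · refine ⟨n, (hw _).2.1, fun m => ?_⟩
    rw [← ofInt_le_ofInt]
    exact ⟨fun h => h.trans hle, fun h => h.trans hge⟩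

theorem isWall_leftScaffold (hL : ∀ X ∈ G.leftOptions, HasThermograph X) :
    IsWall fun t => leftScaffold t G :=
  isWall_finMax fun i => (hL _ (mem_range_self i)).isWall_neg_rightWall.sub_id

theorem isWall_neg_rightScaffold (hR : ∀ Y ∈ G.rightOptions, HasThermograph Y) :
    IsWall fun t => -rightScaffold t G := by
  simp only [rightScaffold, ← finMax_neg, neg_add']
  refine isWall_finMax fun j => IsWall.sub_id ?_
  simpa only [neg_neg] using (hR _ (mem_range_self j)).isWall_leftWall

theorem leftScaffold_neg_one (hG : ¬ IsInt G) (hL : ∀ X ∈ G.leftOptions, HasThermograph X) :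
    ∃ n : ℤ, leftScaffold (-1) G = n ∧ ∀ m, G ≤ ofInt m ↔ n ≤ m := by
  obtain ⟨i, hi⟩ := exists_finMax_eq (numLeft_pos hG) fun i => rightWall (-1) (G.left i) - -1
  obtain ⟨n, hn, -⟩ := (hL _ (mem_range_self i)).rightWall_neg_one
  have heq : leftScaffold (-1) G = (n + 1 : ℤ) := by
    rw [leftScaffold, hi, hn, Int.cast_add, Int.cast_one, sub_neg_eq_add]
  refine ⟨n + 1, heq, fun m => ?_⟩
  rw [le_ofInt_iff_leftOptions hG, ← Int.cast_le (R := ZHalf), ← heq, leftScaffold_le_iff hG]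
  refine forall₂_congr fun X hX => ?_
  obtain ⟨k, hk, hle⟩ := (hL X hX).rightWall_neg_one
  rw [hle, hk]
  norm_cast
  lia

theorem rightScaffold_neg_one (hG : ¬ IsInt G) (hR : ∀ Y ∈ G.rightOptions, HasThermograph Y) :
    ∃ n : ℤ, rightScaffold (-1) G = n ∧ ∀ m, ofInt m ≤ G ↔ m ≤ n := by
  obtain ⟨j, hj⟩ := exists_finMin_eq (numRight_pos hG) fun j => leftWall (-1) (G.right j) + -1
  obtain ⟨n, hn, -⟩ := (hR _ (mem_range_self j)).leftWall_neg_one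
  have heq : rightScaffold (-1) G = (n - 1 : ℤ) := by
    rw [rightScaffold, hj, hn, Int.cast_sub, Int.cast_one, sub_eq_add_neg]
  refine ⟨n - 1, heq, fun m => ?_⟩
  rw [ofInt_le_iff_rightOptions hG, ← Int.cast_le (R := ZHalf), ← heq, le_rightScaffold_iff hG]
  refine forall₂_congr fun Y hY => ?_
  obtain ⟨k, hk, hle⟩ := (hR Y hY).leftWall_neg_one
  rw [hle, hk]
  norm_cast
  lia

theorem rightScaffold_lt_leftScaffold_neg_one (hG : ¬ IsInt G)
    (hL : ∀ X ∈ G.leftOptions, HasThermograph X) (hR : ∀ Y ∈ G.rightOptions, HasThermograph Y) :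
    rightScaffold (-1) G < leftScaffold (-1) G := by
  obtain ⟨p, hp, le_p⟩ := leftScaffold_neg_one hG hL
  obtain ⟨q, hq, q_le⟩ := rightScaffold_neg_one hG hR
  have hGp := (le_p p).2 le_rfl
  have hqG := (q_le q).2 le_rfl
  rw [hp, hq, Int.cast_lt]
  refine (ofInt_le_ofInt.1 (hqG.trans hGp)).lt_of_ne ?_
  rintro rfl
  exact hG ⟨q, hGp, hqG⟩

theorem exists_leftScaffold_le_rightScaffold (hG : ¬ IsInt G)
    (hL : ∀ X ∈ G.leftOptions, HasThermograph X) (hR : ∀ Y ∈ G.rightOptions, HasThermograph Y) :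
    ∃ s, leftScaffold s G ≤ rightScaffold s G := by
  set a := finMax fun i => leftWall 0 (G.left i)
  set b := finMin fun j => rightWall 0 (G.right j)
  obtain ⟨s, hs, hab⟩ : ∃ s : ZHalf, 0 ≤ s ∧ a - b ≤ s :=
    ⟨_, le_max_left 0 (a - b), le_max_right _ _⟩
  have left_le : leftScaffold s G ≤ a - s := by
    refine (leftScaffold_le_iff hG).2 ?_
    rintro _ ⟨i, rfl⟩
    have hi := hL _ (mem_range_self i)
    rw [sub_add_cancel]
    exact (hi.rightWall_le_leftWall s).trans <| (hi.isWall_leftWall.antitone hs).trans <|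
      le_finMax (fun i => leftWall 0 (G.left i)) i
  have le_right : b + s ≤ rightScaffold s G := by
    refine (le_rightScaffold_iff hG).2 ?_
    rintro _ ⟨j, rfl⟩
    have hj := hR _ (mem_range_self j)
    rw [add_sub_cancel_right]
    exact (finMin_le (fun j => rightWall 0 (G.right j)) j).trans <|
      (neg_le_neg_iff.1 (hj.isWall_neg_rightWall.antitone hs)).trans (hj.rightWall_le_leftWall s)
  exact ⟨s, by linarith⟩

theorem neg_one_lt_and_isLeast_meetTime (hG : ¬ IsInt G)
    (hL : ∀ X ∈ G.leftOptions, HasThermograph X) (hR : ∀ Y ∈ G.rightOptions, HasThermograph Y) :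
    -1 < meetTime G ∧ IsLeast {t | leftScaffold t G = rightScaffold t G} (meetTime G) := by
  obtain ⟨s, hs⟩ := exists_leftScaffold_le_rightScaffold hG hL hR
  obtain ⟨T, hT, hT'⟩ := exists_isLeast_eq (isWall_leftScaffold hL) (isWall_neg_rightScaffold hR)
    (rightScaffold_lt_leftScaffold_neg_one hG hL hR) hs
  have hmeet : IsLeast {t | leftScaffold t G = rightScaffold t G} (meetTime G) :=
    Classical.epsilon_spec
      (p := fun s => IsLeast {t | leftScaffold t G = rightScaffold t G} s) ⟨T, hT'⟩
  exact ⟨hT'.unique hmeet ▸ hT, hmeet⟩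

theorem temperature_of_isInt (hG : IsInt G) : temperature G = ⊥ := if_pos hG

theorem temperature_of_not_isInt (hG : ¬ IsInt G) : temperature G = meetTime G := if_neg hG

theorem mast_eq_leftScaffold (hG : ¬ IsInt G) : mast G = leftScaffold (meetTime G) G := by
  rw [mast, leftWall_of_not_isInt _ _ hG, if_pos (temperature_of_not_isInt hG).ge]

theorem leftWall_eq_leftScaffold_min (hG : ¬ IsInt G) (t : ZHalf) :
    leftWall t G = leftScaffold (min t (meetTime G)) G := by
  rw [leftWall_of_not_isInt _ _ hG, temperature_of_not_isInt hG, mast_eq_leftScaffold hG]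
  simp only [WithBot.coe_le_coe]
  split_ifs with h
  · rw [min_eq_left h]
  · rw [min_eq_right (not_le.1 h).le]

theorem rightWall_eq_rightScaffold_min (hG : ¬ IsInt G)
    (hT : leftScaffold (meetTime G) G = rightScaffold (meetTime G) G) (t : ZHalf) :
    rightWall t G = rightScaffold (min t (meetTime G)) G := by
  rw [rightWall_of_not_isInt _ _ hG, temperature_of_not_isInt hG, mast_eq_leftScaffold hG, hT]
  simp only [WithBot.coe_le_coe]
  split_ifs with h
  · rw [min_eq_left h]
  · rw [min_eq_right (not_le.1 h).le]

theorem hasThermograph_of_options (hG : ¬ IsInt G) (hL : ∀ X ∈ G.leftOptions, HasThermograph X)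
    (hR : ∀ Y ∈ G.rightOptions, HasThermograph Y) : HasThermograph G := by
  obtain ⟨hT, hmeet, -⟩ := neg_one_lt_and_isLeast_meetTime hG hL hR
  have isWall_left := isWall_leftScaffold hL
  have isWall_right := isWall_neg_rightScaffold hR
  have left_eq := leftWall_eq_leftScaffold_min hG
  have right_eq := rightWall_eq_rightScaffold_min hG hmeet
  constructor
  · simpa only [left_eq] using isWall_left.comp_min (meetTime G)
  · simpa only [right_eq] using isWall_right.comp_min (meetTime G)
  · intro t
    have ht := min_le_right t (meetTime G)
    rw [left_eq, right_eq]
    calc rightScaffold (min t (meetTime G)) G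
      _ ≤ rightScaffold (meetTime G) G := neg_le_neg_iff.1 (isWall_right.antitone ht)
      _ = leftScaffold (meetTime G) G := hmeet.symm
      _ ≤ leftScaffold (min t (meetTime G)) G := isWall_left.antitone ht
  · rw [left_eq, min_eq_left hT.le]
    exact leftScaffold_neg_one hG hL
  · rw [right_eq, min_eq_left hT.le]
    exact rightScaffold_neg_one hG hR

theorem hasThermograph (G : FormalGame) : HasThermograph G := by
  induction G with
  | mk L R ihL ihR =>
    by_cases h : IsInt (mk L R)
    · exact hasThermograph_of_isInt h
    · exact hasThermograph_of_options h (forall_mem_range.2 ihL) (forall_mem_range.2 ihR)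

theorem neg_one_lt_meetTime (hG : ¬ IsInt G) : -1 < meetTime G :=
  (neg_one_lt_and_isLeast_meetTime hG (fun X _ => hasThermograph X) fun Y _ => hasThermograph Y).1

theorem leftScaffold_meetTime (hG : ¬ IsInt G) :
    leftScaffold (meetTime G) G = rightScaffold (meetTime G) G :=
  (neg_one_lt_and_isLeast_meetTime hG (fun X _ => hasThermograph X)
    fun Y _ => hasThermograph Y).2.1

theorem leftWall_antitone (G : FormalGame) {s t : ZHalf} (h : s ≤ t) :
    leftWall t G ≤ leftWall s G :=
  (hasThermograph G).isWall_leftWall.antitone h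

theorem rightWall_sub_antitone (G : FormalGame) {s t : ZHalf} (h : s ≤ t) :
    rightWall t G - t ≤ rightWall s G - s :=
  (hasThermograph G).isWall_neg_rightWall.sub_id.antitone h

theorem rightWall_le_leftWall (t : ZHalf) (G : FormalGame) : rightWall t G ≤ leftWall t G :=
  (hasThermograph G).rightWall_le_leftWall t

variable {s t x : ZHalf}

theorem not_isInt_of_le_temperature (h : t ≤ temperature G) : ¬ IsInt G := fun hG =>
  WithBot.not_coe_le_bot t (temperature_of_isInt hG ▸ h)

theorem isInt_of_temperature_eq_bot (h : temperature G = ⊥) : IsInt G := by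
  by_contra hG
  exact WithBot.coe_ne_bot (temperature_of_not_isInt hG ▸ h)

theorem neg_one_lt_of_temperature_eq (h : temperature G = t) : -1 < t := by
  have hG := not_isInt_of_le_temperature h.ge
  rw [temperature_of_not_isInt hG, WithBot.coe_inj] at h
  exact h ▸ neg_one_lt_meetTime hG

theorem leftWall_le_iff (h : t ≤ temperature G) :
    leftWall t G ≤ x ↔ ∀ X ∈ G.leftOptions, rightWall t X ≤ x + t := by
  have hG := not_isInt_of_le_temperature h
  rw [leftWall_of_not_isInt t G hG, if_pos h, leftScaffold_le_iff hG]

theorem rightWall_le_iff (h : t ≤ temperature G) :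
    rightWall t G ≤ x ↔ ∃ Y ∈ G.rightOptions, leftWall t Y ≤ x - t := by
  have hG := not_isInt_of_le_temperature h
  rw [rightWall_of_not_isInt t G hG, if_pos h, rightScaffold, finMin_le_iff (numRight_pos hG),
    rightOptions, exists_range_iff]
  simp only [le_sub_iff_add_le]

theorem leftWall_eq_of_temperature_le (h : temperature G ≤ s) (hst : s ≤ t) :
    leftWall t G = leftWall s G := by
  by_cases hG : IsInt G
  · obtain ⟨n, -, hn⟩ := exists_ofInt_of_isInt hG
    rw [(hn t).1, (hn s).1]
  · rw [temperature_of_not_isInt hG, WithBot.coe_le_coe] at h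
    rw [leftWall_eq_leftScaffold_min hG, leftWall_eq_leftScaffold_min hG, min_eq_right h,
      min_eq_right (h.trans hst)]

theorem rightWall_eq_leftWall_of_temperature_le (h : temperature G ≤ t) :
    rightWall t G = leftWall t G := by
  by_cases hG : IsInt G
  · obtain ⟨n, -, hn⟩ := exists_ofInt_of_isInt hG
    rw [(hn t).1, (hn t).2.1]
  · have hT := leftScaffold_meetTime hG
    rw [temperature_of_not_isInt hG, WithBot.coe_le_coe] at h
    rw [leftWall_eq_leftScaffold_min hG, rightWall_eq_rightScaffold_min hG hT, min_eq_right h, hT]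

theorem leftScaffold_neg_of_rightOptions
    (h : ∀ Y ∈ G.rightOptions, rightWall t (-Y) = -leftWall t Y) :
    leftScaffold t (-G) = -rightScaffold t G := by
  cases G with
  | mk L R =>
    rw [rightScaffold, ← finMax_neg]
    exact congrArg finMax <| funext fun j =>
      (congrArg (· - t) (h _ (mem_range_self j))).trans (neg_add' _ _).symm

theorem rightScaffold_neg_of_leftOptions
    (h : ∀ X ∈ G.leftOptions, leftWall t (-X) = -rightWall t X) :
    rightScaffold t (-G) = -leftScaffold t G := by
  rw [← neg_eq_iff_eq_neg, ← leftScaffold_neg_of_rightOptions, G.neg_neg]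
  rw [rightOptions_neg, forall_mem_image]
  intro X hX
  rw [X.neg_neg, h X hX, neg_neg]

theorem walls_neg_of_isInt (hG : IsInt G) (t : ZHalf) :
    leftWall t (-G) = -rightWall t G ∧ rightWall t (-G) = -leftWall t G := by
  obtain ⟨n, hn, hn'⟩ := exists_ofInt_of_isInt hG
  obtain ⟨m, hm, hm'⟩ := exists_ofInt_of_isInt (isInt_neg_iff.2 hG)
  have hmn : Equal (ofInt m) (ofInt (-n)) := by
    rw [← value_eq_value, ← value_eq_value.2 hm, ofInt_neg, value_neg, value_neg,
      value_eq_value.2 hn]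
  rw [(hn' t).1, (hn' t).2.1, (hm' t).1, (hm' t).2.1,
    (ofInt_le_ofInt.1 hmn.1).antisymm (ofInt_le_ofInt.1 hmn.2), Int.cast_neg]
  exact ⟨rfl, rfl⟩

theorem meetTime_neg_of_scaffold_neg (hl : ∀ t, leftScaffold t (-G) = -rightScaffold t G)
    (hr : ∀ t, rightScaffold t (-G) = -leftScaffold t G) : meetTime (-G) = meetTime G := by
  simp only [meetTime, firstMeet, hl, hr, neg_inj, eq_comm]

theorem walls_neg (G : FormalGame) (t : ZHalf) :
    leftWall t (-G) = -rightWall t G ∧ rightWall t (-G) = -leftWall t G := by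
  by_cases hG : IsInt G
  · exact walls_neg_of_isInt hG t
  have hG' := isInt_neg_iff.not.2 hG
  have hl (t) : leftScaffold t (-G) = -rightScaffold t G :=
    leftScaffold_neg_of_rightOptions fun Y _ => (walls_neg Y t).2
  have hr (t) : rightScaffold t (-G) = -leftScaffold t G :=
    rightScaffold_neg_of_leftOptions fun X _ => (walls_neg X t).1
  have hT := meetTime_neg_of_scaffold_neg hl hr
  rw [leftWall_eq_leftScaffold_min hG', leftWall_eq_leftScaffold_min hG,
    rightWall_eq_rightScaffold_min hG' (leftScaffold_meetTime hG'),
    rightWall_eq_rightScaffold_min hG (leftScaffold_meetTime hG), hT, hl, hr]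
  exact ⟨rfl, rfl⟩
termination_by G.birthday
decreasing_by
  · exact birthday_lt_of_mem_rightOptions ‹_›
  · exact birthday_lt_of_mem_leftOptions ‹_›

theorem leftWall_neg (t : ZHalf) (G : FormalGame) : leftWall t (-G) = -rightWall t G :=
  (walls_neg G t).1

theorem rightWall_neg (t : ZHalf) (G : FormalGame) : rightWall t (-G) = -leftWall t G :=
  (walls_neg G t).2

theorem temperature_neg (G : FormalGame) : temperature (-G) = temperature G := by
  by_cases hG : IsInt G
  · rw [temperature_of_isInt hG, temperature_of_isInt (isInt_neg_iff.2 hG)]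
  · rw [temperature_of_not_isInt hG, temperature_of_not_isInt (isInt_neg_iff.not.2 hG),
      meetTime_neg_of_scaffold_neg
        (fun t => leftScaffold_neg_of_rightOptions fun Y _ => rightWall_neg t Y)
        fun t => rightScaffold_neg_of_leftOptions fun X _ => leftWall_neg t X]

/-! ### Cooling and stops -/

/-- The value of `G` cooled by `t`. -/
noncomputable def coolValue (t : ZHalf) (G : FormalGame) : Value := value (cool t G)

theorem coolValue_of_isInt (h : IsInt G) : coolValue t G = value G := by
  obtain ⟨n, hn, hn'⟩ := exists_ofInt_of_isInt h
  rw [coolValue, (hn' t).2.2, value_eq_value.2 hn]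

theorem coolValue_of_temperature_lt (h : temperature G < t) :
    coolValue t G = numValue (leftWall t G) := by
  by_cases hG : IsInt G
  · obtain ⟨n, -, hn⟩ := exists_ofInt_of_isInt hG
    rw [coolValue, (hn t).2.2, (hn t).1, value_ofInt]
  · rw [coolValue, cool_of_not_isInt t G hG, leftWall_of_not_isInt t G hG, if_neg h.not_ge,
      if_neg h.not_ge, value_ofDyadic]

theorem value_image_leftOptions_cool (h : t ≤ temperature G) :
    value '' (cool t G).leftOptions = (fun X => coolValue t X - numValue t) '' G.leftOptions := by
  rw [cool_of_not_isInt t G (not_isInt_of_le_temperature h), if_pos h, leftOptions, leftOptions,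
    ← range_comp, ← range_comp]
  exact congrArg range (funext fun i => value_sub _ _)

theorem value_image_rightOptions_cool (h : t ≤ temperature G) :
    value '' (cool t G).rightOptions =
      (fun Y => coolValue t Y + numValue t) '' G.rightOptions := by
  rw [cool_of_not_isInt t G (not_isInt_of_le_temperature h), if_pos h, rightOptions, rightOptions,
    ← range_comp, ← range_comp]
  rfl

theorem forall_leftOptions_cool (h : t ≤ temperature G) {p : Value → Prop} :
    (∀ X ∈ (cool t G).leftOptions, p (value X)) ↔
      ∀ X ∈ G.leftOptions, p (coolValue t X - numValue t) := by
  rw [← forall_mem_image, value_image_leftOptions_cool h, forall_mem_image]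

theorem forall_rightOptions_cool (h : t ≤ temperature G) {p : Value → Prop} :
    (∀ Y ∈ (cool t G).rightOptions, p (value Y)) ↔
      ∀ Y ∈ G.rightOptions, p (coolValue t Y + numValue t) := by
  rw [← forall_mem_image, value_image_rightOptions_cool h, forall_mem_image]

theorem not_coolValue_le_of_mem_leftOptions (h : t ≤ temperature G) (hX : X ∈ G.leftOptions) :
    ¬ coolValue t G ≤ coolValue t X - numValue t :=
  (forall_leftOptions_cool h (p := (¬ coolValue t G ≤ ·))).1
    (fun _ => not_le_of_mem_leftOptions) X hX

theorem not_le_coolValue_of_mem_rightOptions (h : t ≤ temperature G) (hY : Y ∈ G.rightOptions) :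
    ¬ coolValue t Y + numValue t ≤ coolValue t G :=
  (forall_rightOptions_cool h (p := (¬ · ≤ coolValue t G))).1
    (fun _ => not_le_of_mem_rightOptions) Y hY

theorem coolValue_le_coolValue_iff (hG : t ≤ temperature G) (hH : t ≤ temperature H) :
    coolValue t G ≤ coolValue t H ↔
      (∀ X ∈ G.leftOptions, ¬ coolValue t H ≤ coolValue t X - numValue t) ∧
        ∀ Y ∈ H.rightOptions, ¬ coolValue t Y + numValue t ≤ coolValue t G := by
  rw [← forall_leftOptions_cool hG (p := (¬ coolValue t H ≤ ·)),
    ← forall_rightOptions_cool hH (p := (¬ · ≤ coolValue t G))]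
  exact value_le_value_iff_options

theorem value_image_neg (S : Set FormalGame) :
    value '' (Neg.neg '' S) = Neg.neg '' (value '' S) := by
  rw [image_image, image_image]
  rfl

theorem coolValue_neg (t : ZHalf) (G : FormalGame) : coolValue t (-G) = -coolValue t G := by
  rcases le_or_gt (t : WithBot ZHalf) (temperature G) with h | h
  · have h' : t ≤ temperature (-G) := h.trans_eq (temperature_neg G).symm
    rw [coolValue, coolValue, ← value_neg]
    apply value_eq_value_of_options
    · rw [value_image_leftOptions_cool h', leftOptions_neg, leftOptions_neg, value_image_neg,
        value_image_rightOptions_cool h, image_image, image_image]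
      exact image_congr fun Y _ => by rw [coolValue_neg t Y, neg_add']
    · rw [value_image_rightOptions_cool h', rightOptions_neg, rightOptions_neg, value_image_neg,
        value_image_leftOptions_cool h, image_image, image_image]
      exact image_congr fun X _ => by rw [coolValue_neg t X, neg_sub', sub_neg_eq_add]
  · rw [coolValue_of_temperature_lt h, coolValue_of_temperature_lt ((temperature_neg G).trans_lt h),
      leftWall_neg, rightWall_eq_leftWall_of_temperature_le h.le, map_neg]
termination_by G.birthday
decreasing_by
  · exact birthday_lt_of_mem_rightOptions ‹_›
  · exact birthday_lt_of_mem_leftOptions ‹_›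

/-- `x` is the Left stop of the value `a`: `a` is less than every larger number, and greater than
or fuzzy with every smaller number. -/
def IsLeftStop (a : Value) (x : ZHalf) : Prop :=
  (∀ y > x, a ≤ numValue y) ∧ ∀ y < x, ¬ a ≤ numValue y

/-- `x` is the Right stop of the value `a`: `a` is greater than every smaller number, and less than
or fuzzy with every larger number. -/
def IsRightStop (a : Value) (x : ZHalf) : Prop :=
  (∀ y < x, numValue y ≤ a) ∧ ∀ y > x, ¬ numValue y ≤ a

theorem isLeftStop_numValue (x : ZHalf) : IsLeftStop (numValue x) x :=
  ⟨fun _ hy => numValue_le_numValue.2 (le_of_lt hy), fun _ hy =>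
    numValue_le_numValue.not.2 hy.not_ge⟩

theorem IsLeftStop.neg {a : Value} (h : IsLeftStop a x) : IsRightStop (-a) (-x) := by
  refine ⟨fun y hy => ?_, fun y hy => ?_⟩
  · rw [le_neg, ← map_neg]
    exact h.1 (-y) (lt_neg.1 hy)
  · rw [le_neg, ← map_neg]
    exact h.2 (-y) (neg_lt.1 hy)

theorem IsRightStop.neg {a : Value} (h : IsRightStop a x) : IsLeftStop (-a) (-x) := by
  refine ⟨fun y hy => ?_, fun y hy => ?_⟩
  · rw [neg_le, ← map_neg]
    exact h.1 (-y) (neg_lt.1 hy)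
  · rw [neg_le, ← map_neg]
    exact h.2 (-y) (lt_neg.1 hy)

theorem coolValue_le_numValue_of_options (h : t ≤ temperature G)
    (hR : ∀ Y ∈ G.rightOptions, IsLeftStop (coolValue t Y) (leftWall t Y))
    (hx : leftWall t G ≤ x) (hl : ∀ X ∈ G.leftOptions, ¬ numValue (x + t) ≤ coolValue t X) :
    coolValue t G ≤ numValue x := by
  rw [coolValue, ← value_ofDyadic, value_le_value_iff_options, value_ofDyadic,
    forall_leftOptions_cool h (p := (¬ numValue x ≤ ·))]
  refine ⟨fun X hX => ?_, fun Z hZ hle => ?_⟩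
  · rw [le_sub_iff_add_le, ← map_add]
    exact hl X hX
  · obtain ⟨y, hxy, hy⟩ := exists_gt_of_mem_rightOptions_ofDyadic hZ
    obtain ⟨Y, hY, hle'⟩ := (rightWall_le_iff h).1 ((rightWall_le_leftWall t G).trans hx)
    have hYy := (hR Y hY).1 (y - t) (hle'.trans_lt (sub_lt_sub_right hxy t))
    rw [map_sub, le_sub_iff_add_le, ← hy] at hYy
    exact not_le_coolValue_of_mem_rightOptions h hY (hYy.trans hle)

theorem isLeftStop_coolValue_of_options
    (hL : ∀ X ∈ G.leftOptions, IsRightStop (coolValue t X) (rightWall t X))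
    (hR : ∀ Y ∈ G.rightOptions, IsLeftStop (coolValue t Y) (leftWall t Y)) :
    IsLeftStop (coolValue t G) (leftWall t G) := by
  rcases lt_or_ge (temperature G) t with h | h
  · exact coolValue_of_temperature_lt h ▸ isLeftStop_numValue _
  refine ⟨fun y hy => ?_, fun y hy hle => hy.not_ge ((leftWall_le_iff h).2 fun X hX => ?_)⟩
  · refine coolValue_le_numValue_of_options h hR (le_of_lt hy) fun X hX => (hL X hX).2 _ ?_
    exact ((leftWall_le_iff h).1 le_rfl X hX).trans_lt (add_lt_add_left hy t)
  · by_contra! hlt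
    have hyX := (hL X hX).1 _ hlt
    rw [map_add, ← le_sub_iff_add_le] at hyX
    exact not_coolValue_le_of_mem_leftOptions h hX (hle.trans hyX)

theorem stops_coolValue (t : ZHalf) (G : FormalGame) :
    IsLeftStop (coolValue t G) (leftWall t G) ∧ IsRightStop (coolValue t G) (rightWall t G) := by
  refine ⟨isLeftStop_coolValue_of_options (fun X _ => (stops_coolValue t X).2)
    fun Y _ => (stops_coolValue t Y).1, ?_⟩
  rw [← G.neg_neg, coolValue_neg, rightWall_neg]
  refine IsLeftStop.neg (isLeftStop_coolValue_of_options ?_ ?_)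
  · rw [leftOptions_neg, forall_mem_image]
    intro Y _
    rw [coolValue_neg, rightWall_neg]
    exact (stops_coolValue t Y).1.neg
  · rw [rightOptions_neg, forall_mem_image]
    intro X _
    rw [coolValue_neg, leftWall_neg]
    exact (stops_coolValue t X).2.neg
termination_by G.birthday
decreasing_by
  all_goals first
    | exact birthday_lt_of_mem_leftOptions ‹_›
    | exact birthday_lt_of_mem_rightOptions ‹_›

theorem coolValue_le_numValue (h : t ≤ temperature G)
    (hl : ∀ X ∈ G.leftOptions, ¬ numValue (x + t) ≤ coolValue t X) :
    coolValue t G ≤ numValue x := by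
  refine coolValue_le_numValue_of_options h (fun Y _ => (stops_coolValue t Y).1)
    ((leftWall_le_iff h).2 fun X hX => ?_) hl
  by_contra! hlt
  exact hl X hX ((stops_coolValue t X).2.1 _ hlt)

theorem exists_temperature_le_lt (h : temperature G < t) (hst : s < t) :
    ∃ r, s ≤ r ∧ r < t ∧ temperature G ≤ r := by
  induction hG : temperature G with
  | bot => exact ⟨s, le_rfl, hst, bot_le⟩
  | coe u => exact ⟨max s u, le_max_left s u, max_lt hst (WithBot.coe_lt_coe.1 (hG ▸ h)),
      WithBot.coe_le_coe.2 (le_max_right s u)⟩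

theorem not_numValue_le_coolValue_of_rightOptions (hst : s < t)
    (hR : ∀ Y ∈ G.rightOptions, leftWall s Y ≤ x → coolValue t Y ≤ numValue x)
    (hx : rightWall s G ≤ x + s) : ¬ numValue (x + t) ≤ coolValue t G := by
  rcases le_or_gt (t : WithBot ZHalf) (temperature G) with h | h
  · intro hle
    have hs : s ≤ temperature G := (WithBot.coe_le_coe.2 hst.le).trans h
    obtain ⟨Y, hY, hYx⟩ := (rightWall_le_iff hs).1 hx
    rw [add_sub_cancel_right] at hYx
    rw [map_add] at hle
    exact not_le_coolValue_of_mem_rightOptions h hY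
      ((add_le_add_left (hR Y hY hYx) (numValue t)).trans hle)
  · obtain ⟨r, hsr, hrt, hr⟩ := exists_temperature_le_lt h hst
    rw [coolValue_of_temperature_lt h, numValue_le_numValue, not_le]
    have hanti := rightWall_sub_antitone G hsr
    rw [rightWall_eq_leftWall_of_temperature_le hr, ← leftWall_eq_of_temperature_le hr hrt.le]
      at hanti
    linarith

/-- Bounds on the walls at a smaller temperature give bounds on the cooled game itself, and not
merely on its stops. -/
theorem coolValue_bounds_of_lt (hst : s < t) (G : FormalGame) :
    (∀ x, rightWall s G ≤ x + s → ¬ numValue (x + t) ≤ coolValue t G) ∧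
      ∀ x, leftWall s G ≤ x → coolValue t G ≤ numValue x := by
  refine ⟨fun x => not_numValue_le_coolValue_of_rightOptions hst fun Y _ =>
    (coolValue_bounds_of_lt hst Y).2 x, fun x hx => ?_⟩
  rcases le_or_gt (t : WithBot ZHalf) (temperature G) with h | h
  · refine coolValue_le_numValue h fun X hX => (coolValue_bounds_of_lt hst X).1 x ?_
    exact (leftWall_le_iff ((WithBot.coe_le_coe.2 hst.le).trans h)).1 hx X hX
  · rw [coolValue_of_temperature_lt h, numValue_le_numValue]
    exact (leftWall_antitone G hst.le).trans hx
termination_by G.birthday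
decreasing_by
  · exact birthday_lt_of_mem_rightOptions ‹_›
  · exact birthday_lt_of_mem_leftOptions ‹_›

/-! ### Cooling and the order -/

theorem leftWall_le_of_coolValue_le (h : coolValue t H ≤ coolValue t G) :
    leftWall t H ≤ leftWall t G := by
  by_contra! hlt
  obtain ⟨y, hGy, hyH⟩ := exists_between hlt
  exact (stops_coolValue t H).1.2 y hyH (h.trans ((stops_coolValue t G).1.1 y hGy))

theorem rightWall_le_of_not_coolValue_le_sub (h : ¬ coolValue t G ≤ coolValue t H - numValue t) :
    rightWall t H ≤ leftWall t G + t := by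
  by_contra! hlt
  obtain ⟨y, hGy, hyH⟩ := exists_between hlt
  have hG := (stops_coolValue t G).1.1 (y - t) (lt_sub_iff_add_lt.2 hGy)
  have hH := (stops_coolValue t H).2.1 y hyH
  rw [map_sub] at hG
  exact h (hG.trans (sub_le_sub_right hH _))

theorem coolValue_neg_le_neg_sub_iff :
    coolValue t (-H) ≤ coolValue t (-G) - numValue t ↔
      coolValue t G ≤ coolValue t H - numValue t := by
  rw [coolValue_neg, coolValue_neg, ← neg_add', neg_le_neg_iff, le_sub_iff_add_le]

theorem not_coolValue_le_sub_of_isInt_left (ht : -1 < t) (hG : IsInt G) (h : ¬ G ≤ H) :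
    ¬ coolValue t G ≤ coolValue t H - numValue t := by
  obtain ⟨n, hn⟩ := hG
  obtain ⟨m, hm, hmle⟩ := (hasThermograph H).rightWall_neg_one
  have hmn : m < n := by
    by_contra! hnm
    exact h (hn.1.trans ((hmle n).2 hnm))
  have hle : rightWall (-1) H ≤ n + -1 := by
    rw [hm]
    exact_mod_cast Int.le_sub_one_of_lt hmn
  rw [coolValue_of_isInt ⟨n, hn⟩, value_eq_value.2 hn, value_ofInt, le_sub_iff_add_le, ← map_add]
  exact (coolValue_bounds_of_lt ht H).1 n hle

theorem not_coolValue_le_sub_of_isInt_right (ht : -1 < t) (hH : IsInt H) (h : ¬ G ≤ H) :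
    ¬ coolValue t G ≤ coolValue t H - numValue t := by
  rw [← coolValue_neg_le_neg_sub_iff]
  exact not_coolValue_le_sub_of_isInt_left ht (isInt_neg_iff.2 hH)
    ((FormalGame.neg_le_neg_iff H G).not.2 h)

theorem not_coolValue_le_sub_of_mem_left (ht : -1 < t) (hG : ¬ IsInt G) (hX : X ∈ G.leftOptions)
    (h : ∀ s, -1 < s → coolValue s H ≤ coolValue s X) :
    ¬ coolValue t G ≤ coolValue t H - numValue t := by
  have of_le_temperature {s : ZHalf} (hs : -1 < s) (hsG : s ≤ temperature G) :
      ¬ coolValue s G ≤ coolValue s H - numValue s := fun hle =>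
    not_coolValue_le_of_mem_leftOptions hsG hX (hle.trans (sub_le_sub_right (h s hs) _))
  rcases le_or_gt (t : WithBot ZHalf) (temperature G) with htG | htG
  · exact of_le_temperature ht htG
  have hT := temperature_of_not_isInt hG
  have hTt : meetTime G < t := WithBot.coe_lt_coe.1 (hT ▸ htG)
  have hle := rightWall_le_of_not_coolValue_le_sub
    (of_le_temperature (neg_one_lt_meetTime hG) hT.ge)
  rw [← leftWall_eq_of_temperature_le hT.le hTt.le] at hle
  rw [coolValue_of_temperature_lt htG, le_sub_iff_add_le, ← map_add]
  exact (coolValue_bounds_of_lt hTt H).1 _ hle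

theorem not_coolValue_le_sub_of_mem_right (ht : -1 < t) (hH : ¬ IsInt H) (hY : Y ∈ H.rightOptions)
    (h : ∀ s, -1 < s → coolValue s Y ≤ coolValue s G) :
    ¬ coolValue t G ≤ coolValue t H - numValue t := by
  rw [← coolValue_neg_le_neg_sub_iff]
  refine not_coolValue_le_sub_of_mem_left ht (isInt_neg_iff.not.2 hH) (neg_mem_leftOptions hY) ?_
  intro s hs
  rw [coolValue_neg, coolValue_neg]
  exact neg_le_neg (h s hs)

theorem coolValue_le_of_le_temperature_of_lt (hH : t ≤ temperature H) (hG : temperature G < t)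
    (hl : ∀ X ∈ H.leftOptions, ¬ coolValue t G ≤ coolValue t X - numValue t) :
    coolValue t H ≤ coolValue t G := by
  rw [coolValue_of_temperature_lt hG] at hl ⊢
  refine coolValue_le_numValue hH fun X hX => ?_
  rw [map_add, ← le_sub_iff_add_le]
  exact hl X hX

theorem coolValue_le_of_options (h : t ≤ temperature G ∨ t ≤ temperature H)
    (hl : ∀ X ∈ H.leftOptions, ¬ coolValue t G ≤ coolValue t X - numValue t)
    (hr : ∀ Y ∈ G.rightOptions, ¬ coolValue t Y ≤ coolValue t H - numValue t) :
    coolValue t H ≤ coolValue t G := by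
  rcases le_or_gt (t : WithBot ZHalf) (temperature G) with hG | hG
  · rcases le_or_gt (t : WithBot ZHalf) (temperature H) with hH | hH
    · exact (coolValue_le_coolValue_iff hH hG).2
        ⟨hl, fun Y hY => le_sub_iff_add_le.not.1 (hr Y hY)⟩
    · rw [← neg_le_neg_iff, ← coolValue_neg, ← coolValue_neg]
      refine coolValue_le_of_le_temperature_of_lt (hG.trans_eq (temperature_neg G).symm)
        ((temperature_neg H).trans_lt hH) ?_
      rw [leftOptions_neg, forall_mem_image]
      exact fun Y hY => coolValue_neg_le_neg_sub_iff.not.2 (hr Y hY)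
  · exact coolValue_le_of_le_temperature_of_lt (h.resolve_left hG.not_ge) hG hl

theorem coolValue_le_of_forall_le_temperature (ht : -1 < t) (hHG : H ≤ G)
    (h : ∀ s : ZHalf, -1 < s → s ≤ temperature G ∨ s ≤ temperature H →
      coolValue s H ≤ coolValue s G) :
    coolValue t H ≤ coolValue t G := by
  by_cases hGH : t ≤ temperature G ∨ t ≤ temperature H
  · exact h t ht hGH
  rw [← le_max_iff, not_le] at hGH
  have hG := (le_max_left _ _).trans_lt hGH
  have hH := (le_max_right _ _).trans_lt hGH
  induction hs : max (temperature G) (temperature H) with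
  | bot =>
    obtain ⟨hG', hH'⟩ := max_eq_bot.1 hs
    rw [coolValue_of_isInt (isInt_of_temperature_eq_bot hG'),
      coolValue_of_isInt (isInt_of_temperature_eq_bot hH')]
    exact hHG
  | coe s =>
    have hst : s ≤ t := (WithBot.coe_lt_coe.1 (hs ▸ hGH)).le
    have neg_one_lt : -1 < s := (max_choice (temperature G) (temperature H)).elim
      (fun h => neg_one_lt_of_temperature_eq (h.symm.trans hs))
      fun h => neg_one_lt_of_temperature_eq (h.symm.trans hs)
    have hle := leftWall_le_of_coolValue_le (h s neg_one_lt (le_max_iff.1 hs.ge))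
    rwa [coolValue_of_temperature_lt hG, coolValue_of_temperature_lt hH, numValue_le_numValue,
      leftWall_eq_of_temperature_le ((le_max_left _ _).trans_eq hs) hst,
      leftWall_eq_of_temperature_le ((le_max_right _ _).trans_eq hs) hst]

theorem coolValue_mono_and_not_le_sub (G H : FormalGame) :
    (H ≤ G → ∀ t, -1 < t → coolValue t H ≤ coolValue t G) ∧
      (¬ G ≤ H → ∀ t, -1 < t → ¬ coolValue t G ≤ coolValue t H - numValue t) := by
  refine ⟨fun h t ht => ?_, fun h t ht => ?_⟩
  · obtain ⟨hl, hr⟩ := le_iff_options.1 h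
    exact coolValue_le_of_forall_le_temperature ht h fun s hs hsGH => coolValue_le_of_options hsGH
      (fun X hX => (coolValue_mono_and_not_le_sub G X).2 (hl X hX) s hs)
      fun Y hY => (coolValue_mono_and_not_le_sub Y H).2 (hr Y hY) s hs
  · by_cases hG : IsInt G
    · exact not_coolValue_le_sub_of_isInt_left ht hG h
    by_cases hH : IsInt H
    · exact not_coolValue_le_sub_of_isInt_right ht hH h
    rw [le_iff_options] at h
    obtain ⟨X, hX, hHX⟩ | ⟨Y, hY, hYG⟩ :
        (∃ X ∈ G.leftOptions, H ≤ X) ∨ ∃ Y ∈ H.rightOptions, Y ≤ G := by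
      by_contra! hcon
      exact h hcon
    · exact not_coolValue_le_sub_of_mem_left ht hG hX ((coolValue_mono_and_not_le_sub X H).1 hHX)
    · exact not_coolValue_le_sub_of_mem_right ht hH hY ((coolValue_mono_and_not_le_sub G Y).1 hYG)
termination_by G.birthday + H.birthday
decreasing_by
  · exact add_lt_add_right (birthday_lt_of_mem_leftOptions ‹_›) _
  · exact add_lt_add_left (birthday_lt_of_mem_rightOptions ‹_›) _
  · exact add_lt_add_left (birthday_lt_of_mem_leftOptions ‹_›) _
  · exact add_lt_add_right (birthday_lt_of_mem_rightOptions ‹_›) _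

theorem coolValue_mono (ht : -1 < t) (h : H ≤ G) : coolValue t H ≤ coolValue t G :=
  (coolValue_mono_and_not_le_sub G H).1 h t ht

theorem not_coolValue_le_sub (ht : -1 < t) (h : ¬ G ≤ H) :
    ¬ coolValue t G ≤ coolValue t H - numValue t :=
  (coolValue_mono_and_not_le_sub G H).2 h t ht

end FormalGame

theorem theorem6p1 (t : ZHalf) (ht : -1 < t) :
    (∀ G H : FormalGame, G ≥ H → FormalGame.cool t G ≥ FormalGame.cool t H) ∧
    (∀ G H : FormalGame, FormalGame.GreaterOrFuzzy G H →
      FormalGame.GreaterOrFuzzy (FormalGame.cool t G)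
        (FormalGame.cool t H - FormalGame.ofDyadic t)) ∧
    (∀ G H : FormalGame, FormalGame.Equal G H →
      FormalGame.Equal (FormalGame.cool t G) (FormalGame.cool t H)) ∧
    ∃! f : FormalGame.Value → FormalGame.Value,
      ∀ G : FormalGame, f (FormalGame.value G) = FormalGame.value (FormalGame.cool t G) := by
  have mono : ∀ G H : FormalGame, G ≥ H → FormalGame.cool t G ≥ FormalGame.cool t H :=
    fun G H h => FormalGame.coolValue_mono ht h
  have congr : ∀ G H : FormalGame, FormalGame.Equal G H →
      FormalGame.Equal (FormalGame.cool t G) (FormalGame.cool t H) :=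
    fun G H h => ⟨mono H G h.1, mono G H h.2⟩
  refine ⟨mono, fun G H h => ?_, congr, ?_⟩
  · rw [FormalGame.greaterOrFuzzy_iff_not_le] at h ⊢
    rw [← FormalGame.value_le_value, FormalGame.value_sub, FormalGame.value_ofDyadic]
    exact FormalGame.not_coolValue_le_sub ht h
  · refine ⟨Quotient.map (FormalGame.cool t) congr, fun G => rfl, fun f hf => funext fun a => ?_⟩
    obtain ⟨G, rfl⟩ := FormalGame.value_surjective a
    exact hf G
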